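/- \textbf{Definitions.} Let $G=(V,E)$ be a finite, connected, simple graph with a (not necessarily proper) node coloring $col\colon V\to C$. For $v\in V$ and $c\in C$ let $\Gamma(v,c)$ be the set of nodes of color $c$ that are adjacent to $v$ or connected to $v$ by a path of nodes of color $c$. Calling a color $c$ enlarges a territory $W\subseteq V$ to $W\cup\bigcup_{w\in W}\Gamma(w,c)$. A sequence of $b$ colors, called one after the other starting with the territory $\{v_0\}$, conquers $G$ in $b$ moves if the final territory is $V$. The problem \textsc{Honey-Bee-Solitaire} asks, given $G$, a set $C$ of $k'$ colors, $col\colon V\to C$, a start node $v_0\in V$ and a number $b$, whether some color sequence of length $b$ started on $\{v_0\}$ conquers $G$. The graph $G$ is a co-comparability graph if there is a strict partial order $<$ on $V$ that \emph{represents} $G$: two distinct nodes are adjacent in $G$ if and only if they are incomparable in $<$. \textbf{Theorem.} (a) \textsc{Honey-Bee-Solitaire}, restricted to inputs in which $G$ is a connected co-comparability graph and $v_0$ is a minimal or a maximal element of some partial order representing $G$ (the order is not part of the input), can be solved in polynomial time. Here polynomial time means: a single program of a random access machine (unit-cost addition and truncated subtraction of natural numbers, comparisons, registers and arrays, no multiplication)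 decides all these inputs within a number of steps that is polynomial in the total binary length of the input, which consists of $|V|$, $k'$, $v_0$, $b$, the list of the colors of the nodes, and the adjacency matrix. (b) Let $G$ be a finite connected graph represented by the partial order $<$, let $col$ be a proper coloring of $G$ in which exactly $k$ colors occur, and let $v_0$ be a minimal element of $<$. Give weight $0$ to each node that is the largest node of its color (that is, larger than all other nodes of its color), and weight $1$ to all other nodes. Let $OPT$ be the smallest cost of a path in $G$ from $v_0$ to a maximal element of $<$, where the cost of a path is the sum of the weights of its nodes other than the first node $v_0$. Then the smallest number of moves in which $G$ can be conquered from $\{v_0\}$ exists and equals $OPT+k$ if some node other than $v_0$ has the color of $v_0$, and $OPT+k-1$ if $v_0$ is the only node of its color. If $v_0$ is a maximal element instead, the same holds with $<$ replaced by the reversed order. -/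

import Mathlib

namespace HoneyBee

universe u v

/-! ### The solitaire game -/

section Game

variable {V : Type u} {C : Type v}

/-- The color-`c`-neighborhood `Γ(v, c)`: all nodes of color `c` that are adjacent to `v` or can be
reached from `v` along nodes of color `c` (the node `v` itself may have any color). -/
def colorNbhd (G : SimpleGraph V) (col : V → C) (v : V) (c : C) : Set V :=
  {u | col u = c ∧ ∃ p : G.Walk v u, ∀ x ∈ p.support.tail, col x = c}

/-- One move: calling the color `c` with territory `W` yields `W ∪ Γ(W, c)`. -/
def advance (G : SimpleGraph V) (col : V → C) (W : Set V) (c : C) : Set V :=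
  W ∪ ⋃ w ∈ W, colorNbhd G col w c

/-- The territory that the color sequence `γ` conquers when it is started on `W`. -/
def conquered (G : SimpleGraph V) (col : V → C) (W : Set V) (γ : List C) : Set V :=
  γ.foldl (advance G col) W

/-- Some color sequence of length `b`, started on `{v₀}`, conquers all nodes. -/
def ConquerableIn (G : SimpleGraph V) (col : V → C) (v₀ : V) (b : ℕ) : Prop :=
  ∃ γ : List C, γ.length = b ∧ conquered G col {v₀} γ = Set.univ

/-! ### Co-comparability graphs -/

/-- `r` is a strict partial order on the nodes, and the edges of `G` are exactly the pairs of
distinct elements that are incomparable with respect to `r`. -/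
structure IsCocompOrder (G : SimpleGraph V) (r : V → V → Prop) : Prop where
  irrefl : ∀ x, ¬ r x x
  trans : ∀ x y z, r x y → r y z → r x z
  adj_iff : ∀ x y, G.Adj x y ↔ x ≠ y ∧ ¬ r x y ∧ ¬ r y x

/-- `x` is a minimal element of the strict order `r`. -/
def IsMinimalNode (r : V → V → Prop) (x : V) : Prop := ∀ y, ¬ r y x

/-- `x` is a maximal element of the strict order `r`. -/
def IsMaximalNode (r : V → V → Prop) (x : V) : Prop := ∀ y, ¬ r x y

/-! ### The node-weighted shortest path -/

/-- `x` is the largest node of its color with respect to `r`. -/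
def IsColorMax (col : V → C) (r : V → V → Prop) (x : V) : Prop :=
  ∀ y, col y = col x → y ≠ x → r y x

open Classical in
/-- The largest node of each color has weight `0`, every other node has weight `1`. -/
noncomputable def nodeWeight (col : V → C) (r : V → V → Prop) (x : V) : ℕ :=
  if IsColorMax col r x then 0 else 1

/-- The costs of all paths from `v₀` to maximal elements of `r`. The cost of a path is the sum of
the weights of its nodes other than its first node `v₀`. -/
def pathCosts (G : SimpleGraph V) (col : V → C) (r : V → V → Prop) (v₀ : V) : Set ℕ :=
  {q | ∃ (w : V) (p : G.Walk v₀ w), IsMaximalNode r w ∧ p.IsPath ∧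
    q = (p.support.tail.map (nodeWeight col r)).sum}

/-- `OPT` is the least path cost, `k` the number of colors that occur, and the least number of
moves is `OPT + k`, or `OPT + k - 1` if `v₀` is the only node of its color. -/
def OptimumFormula (G : SimpleGraph V) (col : V → C) (r : V → V → Prop) (v₀ : V) : Prop :=
  ∃ opt OPT : ℕ, IsLeast {b | ConquerableIn G col v₀ b} opt ∧
    IsLeast (pathCosts G col r v₀) OPT ∧
    ((∃ u, u ≠ v₀ ∧ col u = col v₀) → opt = OPT + (Set.range col).ncard) ∧
    ((∀ u, u ≠ v₀ → col u ≠ col v₀) → opt + 1 = OPT + (Set.range col).ncard)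

end Game

/-! ### Instances -/

/-- An instance of the decision problem: a graph on `n` nodes, a coloring with colors from a set of
`k` colors, a start node and a bound on the number of moves. -/
structure Instance where
  n : ℕ
  graph : SimpleGraph (Fin n)
  k : ℕ
  col : Fin n → Fin k
  start : Fin n
  bound : ℕ

/-- The answer to the instance is YES. -/
def Instance.IsYes (I : Instance) : Prop :=
  ConquerableIn I.graph I.col I.start I.bound

/-- The admissible instances: the graph is connected, and it is the co-comparability graph of some
partial order in which the start node is minimal or maximal. The order is not part of the
instance. -/
def Instance.IsExtremalCocomp (I : Instance) : Prop :=
  I.graph.Connected ∧ ∃ r : Fin I.n → Fin I.n → Prop, IsCocompOrder I.graph r ∧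
    (IsMinimalNode r I.start ∨ IsMaximalNode r I.start)

open Classical in
/-- The input word of an instance: `n`, `k`, the start node, the bound, the `n` colors, and the
`n × n` adjacency matrix row by row. -/
noncomputable def Instance.encode (I : Instance) : List ℕ :=
  [I.n, I.k, (I.start : ℕ), I.bound] ++ List.ofFn (fun i => (I.col i : ℕ)) ++
    (List.ofFn fun i => List.ofFn fun j => if I.graph.Adj i j then 1 else 0).flatten

/-! ### Random access machines

Programs of a random access machine with registers and arrays of natural numbers. There is no
multiplication: numbers gain at most a constant number of bits in each step, so that polynomial
time in this model is polynomial time on Turing machines. -/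

/-- The contents of the registers and of the arrays (first argument: the array, second argument:
the index). A program mentions only finitely many registers and arrays. -/
structure Store where
  reg : ℕ → ℕ
  arr : ℕ → ℕ → ℕ

/-- Expressions: constants, registers, array cells, addition and truncated subtraction. -/
inductive Expr where
  | const (m : ℕ)
  | reg (i : ℕ)
  | cell (a : ℕ) (e : Expr)
  | add (e₁ e₂ : Expr)
  | sub (e₁ e₂ : Expr)

/-- The value of an expression. -/
def Expr.eval (s : Store) : Expr → ℕ
  | .const m => m
  | .reg i => s.reg i
  | .cell a e => s.arr a (e.eval s)
  | .add e₁ e₂ => e₁.eval s + e₂.eval s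
  | .sub e₁ e₂ => e₁.eval s - e₂.eval s

/-- Programs. `ite e₁ e₂ P Q` runs `P` if `e₁ < e₂` and `Q` otherwise; `while e₁ e₂ P` repeats `P`
as long as `e₁ < e₂`. -/
inductive Prog where
  | skip
  | setReg (i : ℕ) (e : Expr)
  | setCell (a : ℕ) (e₁ e₂ : Expr)
  | seq (P Q : Prog)
  | ite (e₁ e₂ : Expr) (P Q : Prog)
  | while (e₁ e₂ : Expr) (P : Prog)

/-- A configuration: the programs that are still to be run, in this order, and the store. The
machine has halted when no program is left. -/
structure Config where
  todo : List Prog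
  store : Store

/-- One step of computation. -/
def step : Config → Config
  | ⟨[], s⟩ => ⟨[], s⟩
  | ⟨.skip :: K, s⟩ => ⟨K, s⟩
  | ⟨.setReg i e :: K, s⟩ => ⟨K, ⟨Function.update s.reg i (e.eval s), s.arr⟩⟩
  | ⟨.setCell a e₁ e₂ :: K, s⟩ =>
      ⟨K, ⟨s.reg, Function.update s.arr a
        (Function.update (s.arr a) (e₁.eval s) (e₂.eval s))⟩⟩
  | ⟨.seq P Q :: K, s⟩ => ⟨P :: Q :: K, s⟩
  | ⟨.ite e₁ e₂ P Q :: K, s⟩ => ⟨(if e₁.eval s < e₂.eval s then P else Q) :: K, s⟩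
  | ⟨.while e₁ e₂ P :: K, s⟩ =>
      ⟨if e₁.eval s < e₂.eval s then P :: .while e₁ e₂ P :: K else K, s⟩

/-- The initial store: the input word is in array `0`, everything else is `0`. -/
def initStore (w : List ℕ) : Store where
  reg := fun _ => 0
  arr := fun a i => if a = 0 then w.getD i 0 else 0

/-- The length of an input word: the number of binary digits of its entries, and one separator per
entry. -/
def inputSize (w : List ℕ) : ℕ := (w.map fun m => Nat.size m + 1).sum

/-- The decision problem `yes`, restricted to the inputs that satisfy `promise` and are presented
through `enc`, is solvable in polynomial time: a single program halts on each such input after a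
number of steps that is bounded by a polynomial in the input length, and leaves the answer
(`1` for YES, `0` for NO) in register `0`. -/
def SolvableInPolyTime {α : Type} (enc : α → List ℕ) (promise yes : α → Prop) : Prop :=
  ∃ (P : Prog) (T : Polynomial ℕ), ∀ x, promise x →
    ∃ t ≤ T.eval (inputSize (enc x)), ∃ s : Store,
      step^[t] ⟨[P], initStore (enc x)⟩ = ⟨[], s⟩ ∧
      (yes x → s.reg 0 = 1) ∧ (¬ yes x → s.reg 0 = 0)

end HoneyBee

namespace HoneyBee

universe u v

/-! ### The game on co-comparability graphs: a criterion free of the order, and the optimum for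
proper colorings. -/

section Combinatorics

variable {V : Type u} {C : Type v}

/-! ### Territories -/

/-! Every color of a node other than `v₀` must be called at least once, so only the number of
surplus calls matters. It is the least cost in the sense of `Reach` of a walk from `v₀` to a node
satisfying `IsTerminal`; free steps stay inside a color class or lead to a node whose call finishes
its color (`IsFinisher`).

The upper bound `Reach.conquerableIn` needs no order: play along the walk, charge the call of a free
step to the color that it finishes, and at the end call every unfinished color once.

The lower bound uses that a walk cannot pass from below `x` to above `x` without meeting `x` or a
neighbor of `x`. Hence, for minimal `v₀`, maximal nodes are terminal and top nodes of a color
(`IsTop`) are finishers. Given a winning sequence, `IsCocompOrder.reach_of_conquered` maintains that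
each conquered node is reached at cost `d` or lies below a conquered node that is. A call that is
not the last one of its color raises `d` by one. At the last call of a color its top nodes must be
in the territory, and entering their classes is free.

The resulting criterion `IsCocompOrder.conquerableIn_iff` does not mention the order, so it can be
evaluated without knowing one. Its relations are least fixed points on pairs of nodes and are
tabulated by iteration; a small language of terms with sums over the numbers below `n` is compiled
to the machine. For a proper coloring, linked nodes are equal and top nodes are the largest of their
color, so the walk cost becomes the node weight and the formula follows. -/

theorem mem_colorNbhd_self (G : SimpleGraph V) (col : V → C) (x : V) :
    x ∈ colorNbhd G col x (col x) :=
  ⟨rfl, .nil, by simp⟩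

theorem mem_colorNbhd_cons {G : SimpleGraph V} {col : V → C} {u v x : V} {c : C}
    (h : G.Adj u v) (hv : col v = c) (hx : x ∈ colorNbhd G col v c) : x ∈ colorNbhd G col u c := by
  obtain ⟨hc, p, hp⟩ := hx
  refine ⟨hc, .cons h p, fun y hy => ?_⟩
  rw [SimpleGraph.Walk.support_cons, List.tail_cons, SimpleGraph.Walk.mem_support_iff] at hy
  rcases hy with rfl | hy
  · exact hv
  · exact hp y hy

theorem mem_advance {G : SimpleGraph V} {col : V → C} {W : Set V} {c : C} {x : V} :
    x ∈ advance G col W c ↔ x ∈ W ∨ ∃ w ∈ W, x ∈ colorNbhd G col w c := by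
  simp [advance]

theorem subset_advance (G : SimpleGraph V) (col : V → C) (W : Set V) (c : C) :
    W ⊆ advance G col W c := fun _ h => mem_advance.2 (.inl h)

theorem conquered_append (G : SimpleGraph V) (col : V → C) (W : Set V) (γ δ : List C) :
    conquered G col W (γ ++ δ) = conquered G col (conquered G col W γ) δ :=
  List.foldl_append ..

theorem conquered_concat (G : SimpleGraph V) (col : V → C) (W : Set V) (γ : List C) (c : C) :
    conquered G col W (γ ++ [c]) = advance G col (conquered G col W γ) c :=
  conquered_append ..

theorem subset_conquered (G : SimpleGraph V) (col : V → C) (W : Set V) (γ : List C) :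
    W ⊆ conquered G col W γ := by
  induction γ generalizing W with
  | nil => exact subset_rfl
  | cons c γ ih => exact (subset_advance G col W c).trans (ih _)

theorem start_mem_conquered (G : SimpleGraph V) (col : V → C) (v₀ : V) (γ : List C) :
    v₀ ∈ conquered G col {v₀} γ :=
  subset_conquered G col {v₀} γ rfl

theorem mem_of_mem_conquered {G : SimpleGraph V} {col : V → C} {W : Set V} {γ : List C} {x : V}
    (h : x ∈ conquered G col W γ) (hx : col x ∉ γ) : x ∈ W := by
  induction γ generalizing W with
  | nil => exact h
  | cons c γ ih =>
    rw [List.mem_cons, not_or] at hx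
    rcases mem_advance.1 (ih h hx.2) with h | ⟨w, -, h⟩
    · exact h
    · exact absurd h.1 hx.1

/-- Since `u` stays in the territory, it does not matter when `col x` is called; the final calls may
come in any order. -/
theorem mem_conquered_of_mem {G : SimpleGraph V} {col : V → C} {W : Set V} {γ : List C} {u x : V}
    (hu : u ∈ W) (h : x ∈ colorNbhd G col u (col x)) (hx : col x ∈ γ) :
    x ∈ conquered G col W γ := by
  induction γ generalizing W with
  | nil => simp at hx
  | cons c γ ih =>
    by_cases hc : col x = c
    · refine subset_conquered G col _ γ (mem_advance.2 (.inr ⟨u, hu, hc ▸ h⟩))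
    · exact ih (subset_advance G col W c hu) ((List.mem_cons.1 hx).resolve_left hc)

theorem ConquerableIn.mono {G : SimpleGraph V} {col : V → C} {v₀ : V} {a b : ℕ}
    (h : ConquerableIn G col v₀ a) (hab : a ≤ b) : ConquerableIn G col v₀ b := by
  obtain ⟨γ, rfl, hγ⟩ := h
  refine ⟨γ ++ List.replicate (b - γ.length) (col v₀), by simp; omega, ?_⟩
  rw [conquered_append, hγ]
  exact Set.univ_subset_iff.1 (subset_conquered ..)

/-- Two nodes are linked if they are joined by a path of nodes of one color that avoids `v₀`. -/
def Linked (G : SimpleGraph V) (col : V → C) (v₀ : V) : V → V → Prop :=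
  Relation.ReflTransGen fun a b => G.Adj a b ∧ col a = col b ∧ a ≠ v₀ ∧ b ≠ v₀

theorem Linked.symm {G : SimpleGraph V} {col : V → C} {v₀ a b : V} (h : Linked G col v₀ a b) :
    Linked G col v₀ b a := by
  induction h with
  | refl => exact .refl
  | tail _ h ih => exact .head ⟨h.1.symm, h.2.1.symm, h.2.2.2, h.2.2.1⟩ ih

theorem Linked.color_eq {G : SimpleGraph V} {col : V → C} {v₀ a b : V}
    (h : Linked G col v₀ a b) : col a = col b := by
  induction h with
  | refl => rfl
  | tail _ h ih => exact ih.trans h.2.1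

theorem Linked.mem_colorNbhd {G : SimpleGraph V} {col : V → C} {v₀ a b : V}
    (h : Linked G col v₀ a b) : b ∈ colorNbhd G col a (col b) := by
  induction h using Relation.ReflTransGen.head_induction_on with
  | refl => exact mem_colorNbhd_self ..
  | head h h' ih =>
    exact mem_colorNbhd_cons h.1 (Linked.color_eq h') ih

/-- Conquered nodes other than `v₀` come with their monochromatic neighbors. -/
theorem conquered_closed {G : SimpleGraph V} {col : V → C} {v₀ : V} (γ : List C) {a b : V}
    (ha : a ∈ conquered G col {v₀} γ) (hv : a ≠ v₀) (hab : G.Adj a b) (hc : col a = col b) :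
    b ∈ conquered G col {v₀} γ := by
  induction γ using List.reverseRecOn with
  -- This fails for `v₀`, which is owned without a call of its color.
  | nil => exact absurd ha hv
  | append_singleton γ c ih =>
    rw [conquered_concat] at ha ⊢
    rcases mem_advance.1 ha with ha | ⟨w, hw, hac, p, hp⟩
    · exact subset_advance _ _ _ _ (ih ha)
    · refine mem_advance.2 (.inr ⟨w, hw, hc ▸ hac, p.concat hab, fun x hx => ?_⟩)
      have hsup : (p.concat hab).support.tail = p.support.tail ++ [b] := by
        rw [SimpleGraph.Walk.support_concat]
        cases p <;> simp
      rw [hsup, List.mem_append, List.mem_singleton] at hx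
      rcases hx with hx | rfl
      · exact hp x hx
      · exact hc ▸ hac

theorem Linked.mem_conquered {G : SimpleGraph V} {col : V → C} {v₀ a b : V} {γ : List C}
    (h : Linked G col v₀ a b) (ha : a ∈ conquered G col {v₀} γ) :
    b ∈ conquered G col {v₀} γ := by
  induction h with
  | refl => exact ha
  | tail _ h ih => exact conquered_closed γ ih h.2.2.1 h.1 h.2.1

/-- A newly conquered node is linked to a neighbor of the old territory. -/
theorem exists_adj_linked {G : SimpleGraph V} {col : V → C} {v₀ : V} {W : Set V} (hv : v₀ ∈ W)
    {z : V} (hz : z ∉ W) {c : C} (h : z ∈ advance G col W c) :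
    ∃ u ∈ W, ∃ a, G.Adj u a ∧ Linked G col v₀ a z := by
  obtain ⟨w, hw, -, p, hp⟩ := (mem_advance.1 h).resolve_left hz
  -- Induction from the far end: either the last exit from `W` has been met, or the walk so far is
  -- outside `W` and, since `v₀ ∈ W`, avoids `v₀`.
  suffices H : ∀ (w : V) (p : G.Walk w z), (∀ x ∈ p.support.tail, col x = c) →
      (∃ u ∈ W, ∃ a, G.Adj u a ∧ Linked G col v₀ a z) ∨
        (w ∉ W ∧ (col w = c → Linked G col v₀ w z)) from
    (H w p hp).resolve_right fun h => h.1 hw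
  clear h hw hp p w
  intro w p hp
  induction p with
  | nil => exact .inr ⟨hz, fun _ => .refl⟩
  | @cons w w' _ hadj p ih =>
    rw [SimpleGraph.Walk.support_cons, List.tail_cons] at hp
    have hw' : col w' = c := hp _ p.start_mem_support
    rcases ih hz fun x hx => hp x (List.mem_of_mem_tail hx) with h | ⟨h1, h2⟩
    · exact .inl h
    · by_cases hw : w ∈ W
      · exact .inl ⟨w, hw, w', hadj, h2 hw'⟩
      · refine .inr ⟨hw, fun hc => .head ⟨hadj, hc.trans hw'.symm, ?_, ?_⟩ (h2 hw')⟩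
        · rintro rfl; exact hw hv
        · rintro rfl; exact h1 hv

/-! ### Walks that are conquered at little cost -/

/-- Every walk from `v₀` to `v` visits a node from which `x` is conquered by one move. -/
def Separates (G : SimpleGraph V) (col : V → C) (v₀ x v : V) : Prop :=
  ∀ p : G.Walk v₀ v, ∃ u ∈ p.support, x ∈ colorNbhd G col u (col x)

/-- Calling the color of `v` at the end of a walk from `v₀` to `v` finishes this color. -/
def IsFinisher (G : SimpleGraph V) (col : V → C) (v₀ v : V) : Prop :=
  ∀ x, col x = col v → Separates G col v₀ x v

/-- Every walk from `v₀` to `w` dominates the graph. -/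
def IsTerminal (G : SimpleGraph V) (col : V → C) (v₀ w : V) : Prop :=
  ∀ x, Separates G col v₀ x w

/-- There is a walk from `v₀` to the node of cost at most `d`, where a step is free if it stays
within a color class (and does not leave `v₀`) or leads to a node with the property `Z`, and
costs `1` otherwise. -/
inductive Reach (G : SimpleGraph V) (col : V → C) (v₀ : V) (Z : V → Prop) : ℕ → V → Prop
  | start (d : ℕ) : Reach G col v₀ Z d v₀
  | free {d : ℕ} {u v : V} : Reach G col v₀ Z d u → G.Adj u v →
      (col u = col v ∧ u ≠ v₀ ∨ Z v) → Reach G col v₀ Z d v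
  | pay {d : ℕ} {u v : V} : Reach G col v₀ Z d u → G.Adj u v → Reach G col v₀ Z (d + 1) v

theorem Reach.weaken {G : SimpleGraph V} {col : V → C} {v₀ : V} {Z Z' : V → Prop} {d : ℕ} {v : V}
    (h : Reach G col v₀ Z d v) (hZ : ∀ x, Z x → Z' x) : Reach G col v₀ Z' d v := by
  induction h with
  | start d => exact .start d
  | free _ h1 h2 ih => exact ih.free h1 (h2.imp_right (hZ _))
  | pay _ h1 ih => exact ih.pay h1

theorem Reach.succ {G : SimpleGraph V} {col : V → C} {v₀ : V} {Z : V → Prop} {d : ℕ} {v : V}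
    (h : Reach G col v₀ Z d v) : Reach G col v₀ Z (d + 1) v := by
  induction h with
  | start d => exact .start _
  | free _ h1 h2 ih => exact ih.free h1 h2
  | pay _ h1 ih => exact ih.pay h1

theorem Reach.linked {G : SimpleGraph V} {col : V → C} {v₀ : V} {Z : V → Prop} {d : ℕ} {a b : V}
    (h : Reach G col v₀ Z d a) (hab : Linked G col v₀ a b) : Reach G col v₀ Z d b := by
  induction hab with
  | refl => exact h
  | tail _ h' ih => exact ih.free h'.1 (.inl ⟨h'.2.1, h'.2.2.1⟩)

theorem Reach.of_walk {G : SimpleGraph V} {col : V → C} {v₀ w : V} {Z : V → Prop}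
    (p : G.Walk v₀ w) : Reach G col v₀ Z p.length w := by
  induction p using SimpleGraph.Walk.concatRec with
  | Hnil => exact .start _
  | Hconcat p h ih => rw [SimpleGraph.Walk.length_concat]; exact ih.pay h

/-- The number of colors of the nodes other than `v₀`. -/
noncomputable def otherColors (col : V → C) (v₀ : V) : ℕ := (col '' {v | v ≠ v₀}).ncard

-- The set `S` collects the finished colors. A call made on a free step puts a new color into `S`,
-- so only paid steps count towards `d`.
open Classical in
theorem Reach.exists_conquered {G : SimpleGraph V} {col : V → C} {v₀ : V} {d : ℕ} {v : V}
    (h : Reach G col v₀ (IsFinisher G col v₀) d v) :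
    ∃ (γ : List C) (S : Finset C) (p : G.Walk v₀ v),
      (∀ u ∈ p.support, u ∈ conquered G col {v₀} γ) ∧
      (∀ x, col x ∈ S → x ∈ conquered G col {v₀} γ) ∧
      (S : Set C) ⊆ col '' {v | v ≠ v₀} ∧ γ.length ≤ d + S.card := by
  induction h with
  | start d => exact ⟨[], ∅, .nil, by simp [conquered], by simp, by simp, by simp⟩
  | @free d u v _ hadj hfree ih =>
    obtain ⟨γ, S, p, hp, hS, hSc, hlen⟩ := ih
    have hsupp : ∀ γ' : List C, v ∈ conquered G col {v₀} (γ ++ γ') →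
        ∀ x ∈ (p.concat hadj).support, x ∈ conquered G col {v₀} (γ ++ γ') := by
      intro γ' hv x hx
      rw [SimpleGraph.Walk.support_concat, List.mem_append, List.mem_singleton] at hx
      rcases hx with hx | rfl
      · rw [conquered_append]; exact subset_conquered _ _ _ _ (hp x hx)
      · exact hv
    by_cases hv : v ∈ conquered G col {v₀} γ
    · exact ⟨γ, S, p.concat hadj, by simpa using hsupp [] (by simpa using hv), hS, hSc, hlen⟩
    rcases hfree with ⟨hc, hu⟩ | hfin
    · exact absurd (conquered_closed γ (hp u p.end_mem_support) hu hadj hc) hv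
    have hall : ∀ x, col x = col v → x ∈ conquered G col {v₀} (γ ++ [col v]) := by
      intro x hx
      rw [conquered_concat]
      -- The separating node is already owned, or it is `v`, through which the same call reaches `x`
      -- from `u`.
      obtain ⟨u', hu', hxu⟩ := hfin x hx (p.concat hadj)
      rw [SimpleGraph.Walk.support_concat, List.mem_append, List.mem_singleton] at hu'
      rw [hx] at hxu
      rcases hu' with hu' | rfl
      · exact mem_advance.2 (.inr ⟨u', hp u' hu', hxu⟩)
      · exact mem_advance.2 (.inr ⟨u, hp u p.end_mem_support, mem_colorNbhd_cons hadj rfl hxu⟩)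
    refine ⟨γ ++ [col v], insert (col v) S, p.concat hadj, hsupp _ (hall v rfl), ?_, ?_, ?_⟩
    · intro x hx
      rcases Finset.mem_insert.1 hx with hx | hx
      · exact hall x hx
      · rw [conquered_append]; exact subset_conquered _ _ _ _ (hS x hx)
    · rw [Finset.coe_insert]
      refine Set.insert_subset ⟨v, ?_, rfl⟩ hSc
      rintro rfl
      exact hv (start_mem_conquered ..)
    -- The color is new in `S`: otherwise `v` would be conquered already.
    · rw [Finset.card_insert_of_notMem fun h => hv (hS v h), List.length_append,
        List.length_singleton]
      omega
  | @pay d u v _ hadj ih =>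
    obtain ⟨γ, S, p, hp, hS, hSc, hlen⟩ := ih
    refine ⟨γ ++ [col v], S, p.concat hadj, ?_, ?_, hSc, by simp; omega⟩
    · intro x hx
      rw [conquered_concat]
      rw [SimpleGraph.Walk.support_concat, List.mem_append, List.mem_singleton] at hx
      rcases hx with hx | rfl
      · exact subset_advance _ _ _ _ (hp x hx)
      · exact mem_advance.2 (.inr ⟨u, hp u p.end_mem_support,
          mem_colorNbhd_cons hadj rfl (mem_colorNbhd_self ..)⟩)
    · intro x hx
      rw [conquered_concat]
      exact subset_advance _ _ _ _ (hS x hx)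

/-- By terminality every node is one call away from the owned walk. One call per color outside `S`
finishes the game, and `S.card` cancels in the total. -/
theorem Reach.conquerableIn [Finite V] {G : SimpleGraph V} {col : V → C} {v₀ : V} {d : ℕ} {w : V}
    (h : Reach G col v₀ (IsFinisher G col v₀) d w) (hw : IsTerminal G col v₀ w) :
    ConquerableIn G col v₀ (d + otherColors col v₀) := by
  classical
  obtain ⟨γ, S, p, hp, hS, hSc, hlen⟩ := h.exists_conquered
  have hfin : (col '' {v | v ≠ v₀}).Finite := Set.toFinite _
  have hsub : S ⊆ hfin.toFinset := by
    rw [← Finset.coe_subset]; simpa using hSc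
  have hcard : otherColors col v₀ = hfin.toFinset.card := Set.ncard_eq_toFinset_card _ hfin
  refine ConquerableIn.mono (a := (γ ++ (hfin.toFinset \ S).toList).length) ⟨_, rfl, ?_⟩ ?_
  · refine Set.eq_univ_of_forall fun x => ?_
    rw [conquered_append]
    by_cases hx : x = v₀
    · subst hx
      exact subset_conquered _ _ _ _ (start_mem_conquered ..)
    by_cases hxS : col x ∈ S
    · exact subset_conquered _ _ _ _ (hS x hxS)
    · obtain ⟨u, hu, hxu⟩ := hw x p
      refine mem_conquered_of_mem (hp u hu) hxu ?_
      rw [Finset.mem_toList, Finset.mem_sdiff, Set.Finite.mem_toFinset]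
      exact ⟨⟨x, hx, rfl⟩, hxS⟩
  · rw [List.length_append, Finset.length_toList, Finset.card_sdiff_of_subset hsub, hcard]
    have := Finset.card_le_card hsub
    omega

/-! ### The lower bound for co-comparability graphs -/

theorem IsCocompOrder.swap {G : SimpleGraph V} {r : V → V → Prop} (h : IsCocompOrder G r) :
    IsCocompOrder G fun x y => r y x :=
  ⟨h.irrefl, fun _ _ _ h1 h2 => h.trans _ _ _ h2 h1, fun x y => by rw [h.adj_iff]; tauto⟩

/-- All nodes of the same color that are larger than `y` are linked to `y`. -/
def IsTop (G : SimpleGraph V) (col : V → C) (r : V → V → Prop) (v₀ y : V) : Prop :=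
  ∀ x, col x = col y → Linked G col v₀ x y ∨ ¬ r y x

/-- Were all nodes of the walk comparable to `x`, then, starting below `x`, the walk would stay
below: a step from below `x` to above `x` would join comparable nodes. -/
theorem IsCocompOrder.separates {G : SimpleGraph V} {col : V → C} {r : V → V → Prop}
    (hr : IsCocompOrder G r) {v₀ : V} (hmin : IsMinimalNode r v₀) {x w : V} (hw : ¬ r w x) :
    Separates G col v₀ x w := by
  intro p
  by_contra! hp
  have hcmp : ∀ u ∈ p.support, r u x ∨ r x u := by
    intro u hu
    by_contra! h
    by_cases hux : u = x
    · exact hp u hu (hux ▸ mem_colorNbhd_self ..)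
    · exact hp u hu
        (mem_colorNbhd_cons ((hr.adj_iff u x).2 ⟨hux, h.1, h.2⟩) rfl (mem_colorNbhd_self ..))
  have hstart : r v₀ x := (hcmp v₀ p.start_mem_support).resolve_right (hmin x)
  clear hp hmin
  apply hw
  induction p with
  | nil => exact hstart
  | @cons u u' w hadj p ih =>
    refine ih hw (fun y hy => hcmp y (List.mem_cons_of_mem _ hy)) ?_
    refine (hcmp u' (List.mem_cons_of_mem _ p.start_mem_support)).resolve_right fun h => ?_
    exact ((hr.adj_iff u u').1 hadj).2.1 (hr.trans _ _ _ hstart h)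

theorem IsTop.isFinisher {G : SimpleGraph V} {col : V → C} {r : V → V → Prop}
    (hr : IsCocompOrder G r) {v₀ : V} (hmin : IsMinimalNode r v₀) {y : V}
    (hy : IsTop G col r v₀ y) : IsFinisher G col v₀ y := by
  intro x hx
  rcases hy x hx with h | h
  · exact fun p => ⟨y, p.end_mem_support, h.symm.mem_colorNbhd⟩
  · exact hr.separates hmin h

theorem IsMaximalNode.isTerminal {G : SimpleGraph V} {col : V → C} {r : V → V → Prop}
    (hr : IsCocompOrder G r) {v₀ : V} (hmin : IsMinimalNode r v₀) {w : V}
    (hw : IsMaximalNode r w) : IsTerminal G col v₀ w :=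
  fun _ => hr.separates hmin (hw _)

/-- A node above `a` is above all nodes linked to `a`, or it is close to them. -/
theorem IsCocompOrder.linked_lt {G : SimpleGraph V} {col : V → C} {r : V → V → Prop}
    (hr : IsCocompOrder G r) {v₀ a b y : V} (hab : Linked G col v₀ a b) (hay : r a y) :
    r b y ∨ ∃ c, Linked G col v₀ c b ∧ (c = y ∨ G.Adj c y) := by
  induction hab with
  | refl => exact .inl hay
  | @tail b c _ h ih =>
    rcases ih with ih | ⟨d, hd, h'⟩
    · by_cases hc : c = y ∨ G.Adj c y
      · exact .inr ⟨c, .refl, hc⟩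
      · rw [hr.adj_iff c y] at hc
        by_cases hcy : r c y
        · exact .inl hcy
        · have hyc : r y c := by tauto
          exact absurd (hr.trans _ _ _ ih hyc) ((hr.adj_iff b c).1 h.1).2.1
    · exact .inr ⟨d, .tail hd h, h'⟩

/-- A class may be entered at a node other than its top node, so the property has to spread over the
class. A node `x` of the color above `a` is above `b`, or equal or adjacent to a node linked to `b`;
in each case it is linked to `b`. -/
theorem IsTop.of_linked {G : SimpleGraph V} {col : V → C} {r : V → V → Prop}
    (hr : IsCocompOrder G r) {v₀ : V} (hmin : IsMinimalNode r v₀) {a b : V} (hb : b ≠ v₀)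
    (hab : Linked G col v₀ a b) (h : IsTop G col r v₀ b) : IsTop G col r v₀ a := by
  intro x hx
  by_cases hax : r a x
  · refine .inl ?_
    suffices Linked G col v₀ x b from .trans this hab.symm
    rcases hr.linked_lt hab hax with hbx | ⟨c, hc, rfl | hcx⟩
    · exact (h x (hx.trans hab.color_eq)).resolve_right fun h => h hbx
    · exact hc
    · refine .head ⟨hcx.symm, ?_, ?_, ?_⟩ hc
      · rw [hx, hab.color_eq, hc.color_eq]
      · rintro rfl; exact hmin _ hax
      · rintro rfl
        rcases Relation.ReflTransGen.cases_head hc with h | ⟨d, h, -⟩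
        · exact hb h.symm
        · exact h.2.2.1 rfl
  · exact .inr hax

/-- A maximal one among the larger nodes of the same color has no node of its color above it. -/
theorem IsCocompOrder.exists_isTop [Finite V] {G : SimpleGraph V} {col : V → C}
    {r : V → V → Prop} (hr : IsCocompOrder G r) {v₀ z : V} (hz : ¬ IsTop G col r v₀ z) :
    ∃ x, col x = col z ∧ r z x ∧ IsTop G col r v₀ x := by
  have : IsTrans V (fun x y => r y x) := ⟨fun _ _ _ h1 h2 => hr.trans _ _ _ h2 h1⟩
  have : Std.Irrefl (fun x y => r y x) := ⟨hr.irrefl⟩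
  have hwf : WellFounded (fun x y => r y x) := Finite.wellFounded_of_trans_of_irrefl _
  simp only [IsTop, not_forall, not_or, not_not] at hz
  obtain ⟨y, hy, -, hzy⟩ := hz
  obtain ⟨x, ⟨hx1, hx2⟩, hx3⟩ := hwf.has_min {x | col x = col z ∧ r z x} ⟨y, hy, hzy⟩
  exact ⟨x, hx1, hx2, fun w hw => .inr fun h =>
    hx3 w ⟨hw.trans hx1, hr.trans _ _ _ hx2 h⟩ h⟩

theorem IsCocompOrder.exists_maximal [Finite V] {G : SimpleGraph V}
    {r : V → V → Prop} (hr : IsCocompOrder G r) (v₀ : V) : ∃ w, IsMaximalNode r w := by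
  have : IsTrans V (fun x y => r y x) := ⟨fun _ _ _ h1 h2 => hr.trans _ _ _ h2 h1⟩
  have : Std.Irrefl (fun x y => r y x) := ⟨hr.irrefl⟩
  have hwf : WellFounded (fun x y => r y x) := Finite.wellFounded_of_trans_of_irrefl _
  obtain ⟨x, -, hx⟩ := hwf.has_min Set.univ ⟨v₀, trivial⟩
  exact ⟨x, fun y h => hx y trivial h⟩

/-- If the entry point `a` into the class of a new node is reached at cost `e` from every reached
neighbor, the node itself or a larger node of the old territory is reached at cost `e`. -/
theorem IsCocompOrder.reach_advance {G : SimpleGraph V} {col : V → C} {r : V → V → Prop}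
    (hr : IsCocompOrder G r) {v₀ : V} {Z : V → Prop} {γ : List C} {c : C} {d e : ℕ}
    (ih : ∀ z ∈ conquered G col {v₀} γ, Reach G col v₀ Z d z ∨
      ∃ z' ∈ conquered G col {v₀} γ, r z z' ∧ Reach G col v₀ Z d z')
    (hde : ∀ v, Reach G col v₀ Z d v → Reach G col v₀ Z e v)
    {z : V} (hz : z ∈ conquered G col {v₀} (γ ++ [c]))
    (hstep : z ∉ conquered G col {v₀} γ → ∀ u a, Linked G col v₀ a z → G.Adj u a →
      Reach G col v₀ Z d u → Reach G col v₀ Z e a) :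
    Reach G col v₀ Z e z ∨
      ∃ z' ∈ conquered G col {v₀} (γ ++ [c]), r z z' ∧ Reach G col v₀ Z e z' := by
  rw [conquered_concat] at hz ⊢
  have hsub := subset_advance G col (conquered G col {v₀} γ) c
  by_cases hzγ : z ∈ conquered G col {v₀} γ
  · rcases ih z hzγ with h | ⟨z', h1, h2, h3⟩
    · exact .inl (hde _ h)
    · exact .inr ⟨z', hsub h1, h2, hde _ h3⟩
  obtain ⟨u, hu, a, hadj, haz⟩ := exists_adj_linked (start_mem_conquered ..) hzγ hz
  have hstep := hstep hzγ
  have hnew : ∀ b, Linked G col v₀ b z → b ∉ conquered G col {v₀} γ :=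
    fun b hb h => hzγ (hb.mem_conquered h)
  rcases ih u hu with h | ⟨u', hu', huu', h⟩
  · exact .inl ((hstep u a haz hadj h).linked haz)
  · have hau : a ≠ u' := by rintro rfl; exact hnew a haz hu'
    by_cases hadj' : G.Adj u' a
    · exact .inl ((hstep u' a haz hadj' h).linked haz)
    · have hlt : r a u' := by
        rw [hr.adj_iff] at hadj'
        have h1 : ¬ r u' a := fun h' =>
          ((hr.adj_iff u a).1 hadj).2.1 (hr.trans _ _ _ huu' h')
        by_contra h2
        exact hadj' ⟨hau.symm, h1, h2⟩
      -- Either `u'` is also above `z`, or the class of `z` can be entered from `u'` directly.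
      rcases hr.linked_lt haz hlt with h' | ⟨b, hb, rfl | hbu⟩
      · exact .inr ⟨u', hsub hu', h', hde _ h⟩
      · exact absurd hu' (hnew _ hb)
      · exact .inl ((hstep u' b hb hbu.symm h).linked hb)

-- The set `γ.toFinset \ δ.toFinset` consists of the colors whose last call lies in `γ`; these calls
-- are free. In the induction the last letter of `γ` moves to the front of `δ`.
open Classical in
theorem IsCocompOrder.reach_of_conquered [Finite V] {G : SimpleGraph V} {col : V → C}
    {r : V → V → Prop} (hr : IsCocompOrder G r) {v₀ : V} (hmin : IsMinimalNode r v₀)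
    (γ δ : List C) (hγ : conquered G col {v₀} (γ ++ δ) = Set.univ) :
    ∃ d, d + (γ.toFinset \ δ.toFinset).card ≤ γ.length ∧ ∀ z ∈ conquered G col {v₀} γ,
      Reach G col v₀ (IsTop G col r v₀) d z ∨
        ∃ z' ∈ conquered G col {v₀} γ, r z z' ∧ Reach G col v₀ (IsTop G col r v₀) d z' := by
  induction γ using List.reverseRecOn generalizing δ with
  | nil =>
    refine ⟨0, by simp, fun z hz => .inl ?_⟩
    rw [show z = v₀ from hz]
    exact .start 0
  | append_singleton γ c ih =>
    obtain ⟨d, hd, ih⟩ := ih (c :: δ) (by simpa using hγ)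
    by_cases hc : c ∈ δ
    · refine ⟨d + 1, ?_, fun z hz => hr.reach_advance ih (fun _ h => h.succ) hz
        fun _ u a _ hadj h => h.pay hadj⟩
      have : (γ ++ [c]).toFinset \ δ.toFinset = γ.toFinset \ (c :: δ).toFinset := by
        ext x
        simp only [List.toFinset_append, Finset.mem_sdiff, Finset.mem_union, List.mem_toFinset,
          List.mem_cons]
        grind
      rw [this, List.length_append, List.length_singleton]
      omega
    · refine ⟨d, ?_, ?_⟩
      · have : (γ ++ [c]).toFinset \ δ.toFinset = insert c (γ.toFinset \ (c :: δ).toFinset) := by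
          ext x
          simp only [List.toFinset_append, Finset.mem_sdiff, Finset.mem_union, List.mem_toFinset,
            List.mem_cons, Finset.mem_insert]
          grind
        rw [this, List.length_append, List.length_singleton]
        have := Finset.card_insert_le c (γ.toFinset \ (c :: δ).toFinset)
        omega
      · have htop : ∀ z ∈ conquered G col {v₀} (γ ++ [c]), IsTop G col r v₀ z →
            Reach G col v₀ (IsTop G col r v₀) d z ∨ ∃ z' ∈ conquered G col {v₀} (γ ++ [c]),
              r z z' ∧ Reach G col v₀ (IsTop G col r v₀) d z' := by
          intro z hz hzt
          refine hr.reach_advance ih (fun _ h => h) hz fun hzn u a haz hadj h =>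
            h.free hadj (.inr (hzt.of_linked hr hmin ?_ haz))
          rintro rfl
          exact hzn (start_mem_conquered ..)
        intro z hz
        by_cases hzγ : z ∈ conquered G col {v₀} γ
        · rcases ih z hzγ with h | ⟨z', h1, h2⟩
          · exact .inl h
          · refine .inr ⟨z', ?_, h2⟩
            rw [conquered_concat]
            exact subset_advance _ _ _ _ h1
        by_cases hzt : IsTop G col r v₀ z
        · exact htop z hz hzt
        obtain ⟨x, hxz, hzx, hxt⟩ := hr.exists_isTop hzt
        have hzc : col z = c := by
          rw [conquered_concat] at hz
          obtain ⟨w, -, h⟩ := (mem_advance.1 hz).resolve_left hzγ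
          exact h.1
        -- The color `c` is not called again, so its node `x` must be owned by now.
        have hx : x ∈ conquered G col {v₀} (γ ++ [c]) := by
          have : x ∈ conquered G col {v₀} (γ ++ [c] ++ δ) := hγ ▸ Set.mem_univ x
          rw [conquered_append] at this
          exact mem_of_mem_conquered this (by rw [hxz, hzc]; exact hc)
        rcases htop x hx hxt with h | ⟨z', h1, h2, h3⟩
        · exact .inr ⟨x, hx, hzx, h⟩
        · exact .inr ⟨z', h1, hr.trans _ _ _ hzx h2, h3⟩

/-- With `δ` empty every color of `γ` is counted, and nothing lies above a maximal node, so only the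
first alternative of the invariant remains. -/
theorem IsCocompOrder.reach_maximal [Finite V] {G : SimpleGraph V} {col : V → C}
    {r : V → V → Prop} (hr : IsCocompOrder G r) {v₀ : V} (hmin : IsMinimalNode r v₀) {b : ℕ}
    (hb : ConquerableIn G col v₀ b) :
    ∃ d w, IsMaximalNode r w ∧ Reach G col v₀ (IsTop G col r v₀) d w ∧
      d + otherColors col v₀ ≤ b := by
  classical
  obtain ⟨γ, rfl, hγ⟩ := hb
  obtain ⟨d, hd, h⟩ := hr.reach_of_conquered hmin γ [] (by simpa using hγ)
  obtain ⟨w, hw⟩ := hr.exists_maximal v₀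
  refine ⟨d, w, hw, (h w (hγ ▸ Set.mem_univ w)).resolve_right ?_, le_trans ?_ hd⟩
  · rintro ⟨z, -, hz, -⟩
    exact hw z hz
  · refine Nat.add_le_add_left ?_ d
    rw [List.toFinset_nil, Finset.sdiff_empty, ← Set.ncard_coe_finset]
    refine Set.ncard_le_ncard ?_ (Finset.finite_toSet _)
    rintro _ ⟨v, hv, rfl⟩
    by_contra hc
    exact hv (mem_of_mem_conquered (W := {v₀}) (γ := γ) (hγ ▸ Set.mem_univ v) (by simpa using hc))

/-- The game is decided by the cheapest walk to a terminal node. -/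
theorem IsCocompOrder.conquerableIn_iff [Finite V] {G : SimpleGraph V} {col : V → C}
    {r : V → V → Prop} (hr : IsCocompOrder G r) {v₀ : V}
    (hv : IsMinimalNode r v₀ ∨ IsMaximalNode r v₀) (b : ℕ) :
    ConquerableIn G col v₀ b ↔ ∃ d w, Reach G col v₀ (IsFinisher G col v₀) d w ∧
      IsTerminal G col v₀ w ∧ d + otherColors col v₀ ≤ b := by
  -- The claim does not mention `r`, so the order may be reversed.
  wlog hmin : IsMinimalNode r v₀ generalizing r
  · exact this hr.swap (.inl (hv.resolve_left hmin)) (hv.resolve_left hmin)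
  constructor
  · intro h
    obtain ⟨d, w, hw, hd, hle⟩ := hr.reach_maximal hmin h
    exact ⟨d, w, hd.weaken fun _ hx => hx.isFinisher hr hmin, hw.isTerminal hr hmin, hle⟩
  · rintro ⟨d, w, hd, hw, hle⟩
    exact (hd.conquerableIn hw).mono hle

/-! ### The optimum for proper colorings -/

theorem Linked.eq_of_proper {G : SimpleGraph V} {col : V → C} {v₀ a b : V}
    (hcol : ∀ x y, G.Adj x y → col x ≠ col y) (h : Linked G col v₀ a b) : a = b := by
  induction h with
  | refl => rfl
  | tail _ h _ => exact absurd h.2.1 (hcol _ _ h.1)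

theorem IsTop.isColorMax {G : SimpleGraph V} {col : V → C} {r : V → V → Prop}
    (hr : IsCocompOrder G r) (hcol : ∀ x y, G.Adj x y → col x ≠ col y) {v₀ y : V}
    (hy : IsTop G col r v₀ y) : IsColorMax col r y := by
  intro x hx hxy
  have h1 : ¬ r y x := (hy x hx).resolve_left fun h => hxy (h.eq_of_proper hcol)
  by_contra h2
  exact hcol x y ((hr.adj_iff x y).2 ⟨hxy, h2, h1⟩) hx

theorem IsColorMax.isTop {G : SimpleGraph V} {col : V → C} {r : V → V → Prop}
    (hr : IsCocompOrder G r) {v₀ y : V} (hy : IsColorMax col r y) : IsTop G col r v₀ y := by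
  intro x hx
  by_cases hxy : x = y
  · exact .inl (hxy ▸ .refl)
  · exact .inr fun h => hr.irrefl _ (hr.trans _ _ _ h (hy x hx hxy))

theorem Reach.exists_walk {G : SimpleGraph V} {col : V → C} {r : V → V → Prop}
    (hr : IsCocompOrder G r) (hcol : ∀ x y, G.Adj x y → col x ≠ col y) {v₀ w : V} {d : ℕ}
    (h : Reach G col v₀ (IsTop G col r v₀) d w) :
    ∃ p : G.Walk v₀ w, (p.support.tail.map (nodeWeight col r)).sum ≤ d := by
  have hconcat : ∀ {u v : V} (p : G.Walk v₀ u) (h : G.Adj u v),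
      (((p.concat h).support.tail).map (nodeWeight col r)).sum =
        (p.support.tail.map (nodeWeight col r)).sum + nodeWeight col r v := by
    intro u v p h
    have : (p.concat h).support.tail = p.support.tail ++ [v] := by
      rw [SimpleGraph.Walk.support_concat]
      cases p <;> simp
    rw [this]; simp
  induction h with
  | start d => exact ⟨.nil, by simp⟩
  | free _ hadj hf ih =>
    obtain ⟨p, hp⟩ := ih
    refine ⟨p.concat hadj, ?_⟩
    rcases hf with hf | hf
    · exact absurd hf.1 (hcol _ _ hadj)
    · rw [hconcat, nodeWeight, if_pos (hf.isColorMax hr hcol)]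
      exact hp
  | pay _ hadj ih =>
    obtain ⟨p, hp⟩ := ih
    refine ⟨p.concat hadj, ?_⟩
    rw [hconcat, nodeWeight]
    split_ifs <;> omega

theorem Reach.of_nodeWeight {G : SimpleGraph V} {col : V → C} {r : V → V → Prop}
    (hr : IsCocompOrder G r) {v₀ u w : V} (p : G.Walk u w) {d : ℕ}
    (h : Reach G col v₀ (IsTop G col r v₀) d u) :
    Reach G col v₀ (IsTop G col r v₀) (d + (p.support.tail.map (nodeWeight col r)).sum) w := by
  induction p generalizing d with
  | nil => simpa using h
  | @cons u u' w hadj p ih =>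
    have hs : ((SimpleGraph.Walk.cons hadj p).support.tail.map (nodeWeight col r)).sum =
        nodeWeight col r u' + (p.support.tail.map (nodeWeight col r)).sum := by
      rw [SimpleGraph.Walk.support_cons, List.tail_cons, ← p.cons_tail_support,
        List.map_cons, List.sum_cons, List.tail_cons]
    rw [hs, ← add_assoc]
    apply ih
    unfold nodeWeight
    split_ifs with hc
    · exact h.free hadj (.inr (hc.isTop hr))
    · exact h.pay hadj

theorem ncard_range_eq_otherColors [Finite V] {col : V → C} {v₀ : V}
    (h : ∃ u, u ≠ v₀ ∧ col u = col v₀) : (Set.range col).ncard = otherColors col v₀ := by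
  obtain ⟨u, hu, hc⟩ := h
  refine congrArg _ (Set.Subset.antisymm ?_ (Set.image_subset_range ..))
  rintro _ ⟨x, rfl⟩
  by_cases hx : x = v₀
  · exact ⟨u, hu, by rw [hx, hc]⟩
  · exact ⟨x, hx, rfl⟩

theorem ncard_range_eq_otherColors_succ [Finite V] {col : V → C} {v₀ : V}
    (h : ∀ u, u ≠ v₀ → col u ≠ col v₀) : (Set.range col).ncard = otherColors col v₀ + 1 := by
  have : Set.range col = insert (col v₀) (col '' {v | v ≠ v₀}) := by
    ext c
    constructor
    · rintro ⟨x, rfl⟩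
      by_cases hx : x = v₀
      · exact .inl (hx ▸ rfl)
      · exact .inr ⟨x, hx, rfl⟩
    · rintro (rfl | ⟨x, -, rfl⟩) <;> exact ⟨_, rfl⟩
  rw [this, Set.ncard_insert_of_notMem, otherColors]
  rintro ⟨x, hx, hc⟩
  exact h x hx hc

theorem optimumFormula_of_isMinimalNode [Finite V] {G : SimpleGraph V} {col : V → C}
    {r : V → V → Prop} {v₀ : V} (hG : G.Connected) (hr : IsCocompOrder G r)
    (hcol : ∀ x y, G.Adj x y → col x ≠ col y) (hmin : IsMinimalNode r v₀) :
    OptimumFormula G col r v₀ := by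
  classical
  have hlow : ∀ b, ConquerableIn G col v₀ b →
      ∃ q ∈ pathCosts G col r v₀, q + otherColors col v₀ ≤ b := by
    intro b hb
    obtain ⟨d, w, hw, hd, hle⟩ := hr.reach_maximal hmin hb
    obtain ⟨p, hp⟩ := hd.exists_walk hr hcol
    -- Shortcutting a walk to a path only deletes nodes, so the weight does not grow.
    refine ⟨_, ⟨w, p.bypass, hw, p.bypass_isPath, rfl⟩, ?_⟩
    have := (p.support_bypass_sublist_support.tail.map (nodeWeight col r)).sum_le_sum fun _ _ => Nat.zero_le _
    omega
  have hup : ∀ q ∈ pathCosts G col r v₀, ConquerableIn G col v₀ (q + otherColors col v₀) := by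
    rintro q ⟨w, p, hw, -, rfl⟩
    have := (Reach.of_nodeWeight (col := col) hr p (.start 0)).weaken
      fun _ hx => hx.isFinisher hr hmin
    rw [zero_add] at this
    exact this.conquerableIn (hw.isTerminal hr hmin)
  have hne : (pathCosts G col r v₀).Nonempty := by
    obtain ⟨w, hw⟩ := hr.exists_maximal v₀
    obtain ⟨p⟩ := hG.preconnected v₀ w
    exact ⟨_, w, p.bypass, hw, p.bypass_isPath, rfl⟩
  refine ⟨sInf (pathCosts G col r v₀) + otherColors col v₀, sInf (pathCosts G col r v₀),
    ⟨hup _ (Nat.sInf_mem hne), fun b hb => ?_⟩,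
    ⟨Nat.sInf_mem hne, fun q hq => Nat.sInf_le hq⟩, fun h => ?_, fun h => ?_⟩
  · obtain ⟨q, hq, hle⟩ := hlow b hb
    exact (Nat.add_le_add_right (Nat.sInf_le hq) _).trans hle
  · rw [ncard_range_eq_otherColors h]
  · rw [ncard_range_eq_otherColors_succ h, add_assoc]

end Combinatorics

/-! ### Compiling terms with bounded sums, and tables of their values, to polynomial-time machine
programs. -/

section Compiler

open Finset Polynomial

/-! ### Running times of programs -/

/-- The program `P`, started on `s`, ends after at most `T` steps in a store that satisfies `Q`. -/
def Halts (P : Prog) (s : Store) (T : ℕ) (Q : Store → Prop) : Prop :=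
  -- Allowing any remaining work `K` makes runs composable.
  ∃ t ≤ T, ∃ s', (∀ K, step^[t] ⟨P :: K, s⟩ = ⟨K, s'⟩) ∧ Q s'

/-- The store after an assignment to a register. -/
def Store.setReg (s : Store) (i x : ℕ) : Store := ⟨Function.update s.reg i x, s.arr⟩

/-- The store after an assignment to an array cell. -/
def Store.setCell (s : Store) (a i x : ℕ) : Store :=
  ⟨s.reg, Function.update s.arr a (Function.update (s.arr a) i x)⟩

@[simp] theorem Store.setReg_reg (s : Store) (i x : ℕ) :
    (s.setReg i x).reg = Function.update s.reg i x := rfl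

@[simp] theorem Store.setReg_arr (s : Store) (i x : ℕ) : (s.setReg i x).arr = s.arr := rfl

@[simp] theorem Store.setCell_reg (s : Store) (a i x : ℕ) : (s.setCell a i x).reg = s.reg := rfl

@[simp] theorem Store.setCell_arr (s : Store) (a i x : ℕ) :
    (s.setCell a i x).arr = Function.update s.arr a (Function.update (s.arr a) i x) := rfl

theorem Halts.mono {P : Prog} {s : Store} {T T' : ℕ} {Q Q' : Store → Prop} (h : Halts P s T Q)
    (hT : T ≤ T') (hQ : ∀ s', Q s' → Q' s') : Halts P s T' Q' := by
  obtain ⟨t, ht, s', h1, h2⟩ := h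
  exact ⟨t, ht.trans hT, s', h1, hQ _ h2⟩

theorem Halts.setReg {i : ℕ} {e : Expr} {s : Store} {Q : Store → Prop}
    (h : Q (s.setReg i (e.eval s))) : Halts (.setReg i e) s 1 Q :=
  ⟨1, le_rfl, _, fun _ => rfl, h⟩

theorem Halts.setCell {a : ℕ} {e₁ e₂ : Expr} {s : Store} {Q : Store → Prop}
    (h : Q (s.setCell a (e₁.eval s) (e₂.eval s))) : Halts (.setCell a e₁ e₂) s 1 Q :=
  ⟨1, le_rfl, _, fun _ => rfl, h⟩

theorem Halts.seq {P₁ P₂ : Prog} {s : Store} {T₁ T₂ : ℕ} {Q : Store → Prop}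
    (h : Halts P₁ s T₁ fun s' => Halts P₂ s' T₂ Q) : Halts (.seq P₁ P₂) s (T₁ + T₂ + 1) Q := by
  obtain ⟨t₁, ht₁, s₁, h₁, t₂, ht₂, s₂, h₂, hQ⟩ := h
  refine ⟨t₂ + t₁ + 1, by omega, s₂, fun K => ?_, hQ⟩
  rw [Function.iterate_succ_apply, Function.iterate_add_apply]
  change step^[t₂] (step^[t₁] ⟨P₁ :: P₂ :: K, s⟩) = _
  rw [h₁, h₂]

theorem Halts.ite {e₁ e₂ : Expr} {P₁ P₂ : Prog} {s : Store} {T : ℕ} {Q : Store → Prop}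
    (h₁ : e₁.eval s < e₂.eval s → Halts P₁ s T Q)
    (h₂ : ¬ e₁.eval s < e₂.eval s → Halts P₂ s T Q) : Halts (.ite e₁ e₂ P₁ P₂) s (T + 1) Q := by
  have h : Halts (if e₁.eval s < e₂.eval s then P₁ else P₂) s T Q := by
    split_ifs with hc
    · exact h₁ hc
    · exact h₂ hc
  obtain ⟨t, ht, s', h, hQ⟩ := h
  refine ⟨t + 1, by omega, s', fun K => ?_, hQ⟩
  rw [Function.iterate_succ_apply]
  exact h K

/-- A loop in which the register `c` runs through all numbers below the first input number. -/
def forLoop (c : ℕ) (P : Prog) : Prog :=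
  .seq (.setReg c (.const 0)) (.while (.reg c) (.cell 0 (.const 0))
    (.seq P (.setReg c (.add (.reg c) (.const 1)))))

/-- Each round adds a test, a sequencing step and an increment to `T`; the outer `3` is
initialization, sequencing and the failing test. -/
theorem Halts.forLoop {c : ℕ} {P : Prog} {s : Store} {n T : ℕ} {Inv : ℕ → Store → Prop}
    (h0 : Inv 0 (s.setReg c 0))
    (hInv : ∀ j s, Inv j s → s.reg c = j ∧ s.arr 0 0 = n)
    (hstep : ∀ j s, j < n → Inv j s → Halts P s T fun s' => s'.reg c = j ∧
      Inv (j + 1) (s'.setReg c (j + 1))) :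
    Halts (forLoop c P) s (n * (T + 3) + 3) (Inv n) := by
  have key : ∀ k j s, j + k = n → Inv j s → Halts (.while (.reg c) (.cell 0 (.const 0))
      (.seq P (.setReg c (.add (.reg c) (.const 1))))) s (k * (T + 3) + 1) (Inv n) := by
    intro k
    induction k with
    | zero =>
      intro j s hj hs
      obtain ⟨h1, h2⟩ := hInv j s hs
      refine ⟨1, by omega, s, fun K => ?_, by rwa [← hj]⟩
      change Config.mk (if s.reg c < s.arr 0 0 then _ else _) s = _
      rw [if_neg (by omega)]
    | succ k ih =>
      intro j s hj hs
      obtain ⟨h1, h2⟩ := hInv j s hs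
      have hb : Halts (.seq P (.setReg c (.add (.reg c) (.const 1)))) s (T + 1 + 1) (Inv (j + 1)) :=
        .seq ((hstep j s (by omega) hs).mono le_rfl fun s' h =>
          .setReg (by simpa only [Expr.eval, h.1] using h.2))
      obtain ⟨t, ht, s', h, hQ⟩ := hb
      obtain ⟨t', ht', s'', h', hQ'⟩ := ih (j + 1) s' (by omega) hQ
      refine ⟨t' + t + 1, by rw [Nat.succ_mul]; omega, s'', fun K => ?_, hQ'⟩
      rw [Function.iterate_succ_apply, Function.iterate_add_apply]
      have : step ⟨.while (.reg c) (.cell 0 (.const 0))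
          (.seq P (.setReg c (.add (.reg c) (.const 1)))) :: K, s⟩ =
          ⟨.seq P (.setReg c (.add (.reg c) (.const 1))) :: .while (.reg c) (.cell 0 (.const 0))
            (.seq P (.setReg c (.add (.reg c) (.const 1)))) :: K, s⟩ := by
        change Config.mk (if s.reg c < s.arr 0 0 then _ else _) s = _
        rw [if_pos (by omega)]
      rw [this, h, h']
  exact (Halts.seq (.setReg (key n 0 _ (by omega) h0))).mono (by omega) fun _ h => h

/-! ### Terms with bounded sums -/

/-- Terms over ten variables and the arrays. -/
inductive Term where
  | const (m : ℕ)
  | var (i : Fin 10)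
  | cell (a : ℕ) (t : Term)
  | add (t₁ t₂ : Term)
  | sub (t₁ t₂ : Term)
  | ite (t₁ t₂ t₃ t₄ : Term)
  | sum (i : Fin 10) (t : Term)

/-- The value of a term. In a sum the variable runs through all numbers below the first input
number, the first entry of array `0`. -/
def Term.eval (σ : ℕ → ℕ → ℕ) : Term → (Fin 10 → ℕ) → ℕ
  | .const m, _ => m
  | .var i, ρ => ρ i
  | .cell a t, ρ => σ a (t.eval σ ρ)
  | .add t₁ t₂, ρ => t₁.eval σ ρ + t₂.eval σ ρ
  | .sub t₁ t₂, ρ => t₁.eval σ ρ - t₂.eval σ ρ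
  | .ite t₁ t₂ t₃ t₄, ρ =>
      if t₁.eval σ ρ < t₂.eval σ ρ then t₃.eval σ ρ else t₄.eval σ ρ
  | .sum i t, ρ => ∑ j ∈ range (σ 0 0), t.eval σ (Function.update ρ i j)

/-- A program that writes the value of the term into register `r` and uses only larger registers
for its work. Array `a` of the term is array `2 * a` of the machine. -/
def Term.compile : Term → ℕ → Prog
  | .const m, r => .setReg r (.const m)
  | .var i, r => .setReg r (.reg i)
  | .cell a t, r => .seq (t.compile r) (.setReg r (.cell (2 * a) (.reg r)))
  | .add t₁ t₂, r => .seq (t₁.compile r) (.seq (t₂.compile (r + 1))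
      (.setReg r (.add (.reg r) (.reg (r + 1)))))
  | .sub t₁ t₂, r => .seq (t₁.compile r) (.seq (t₂.compile (r + 1))
      (.setReg r (.sub (.reg r) (.reg (r + 1)))))
  | .ite t₁ t₂ t₃ t₄, r => .seq (t₁.compile r) (.seq (t₂.compile (r + 1))
      (.ite (.reg r) (.reg (r + 1)) (t₃.compile r) (t₄.compile r)))
  -- The summation variable serves as loop counter, so its outer value is saved in `r + 1` and
  -- restored.
  | .sum i t, r => .seq (.setReg (r + 1) (.reg i)) (.seq (.setReg r (.const 0))
      (.seq (forLoop i (.seq (t.compile (r + 2)) (.setReg r (.add (.reg r) (.reg (r + 2))))))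
        (.setReg i (.reg (r + 1)))))

/-- A bound on the running time of the compiled term. -/
noncomputable def Term.time : Term → ℕ[X]
  | .const _ => 1
  | .var _ => 1
  | .cell _ t => t.time + 2
  | .add t₁ t₂ => t₁.time + t₂.time + 3
  | .sub t₁ t₂ => t₁.time + t₂.time + 3
  | .ite t₁ t₂ t₃ t₄ => t₁.time + t₂.time + t₃.time + t₄.time + 3
  | .sum _ t => X * (t.time + 5) + 9

/-- The arrays that are visible in terms. -/
def Store.view (s : Store) : ℕ → ℕ → ℕ := fun a => s.arr (2 * a)

/-- The values of the ten variables. -/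
def Store.env (s : Store) : Fin 10 → ℕ := fun i => s.reg i

/-- Arrays stay unchanged, so every loop has the same bound `n`, and the time is a polynomial in
`n`. Preserving the registers below `r` keeps the variables and the intermediate results intact. -/
theorem Term.compile_spec (t : Term) {r : ℕ} (hr : 10 ≤ r) (s : Store) :
    Halts (t.compile r) s (t.time.eval (s.arr 0 0)) fun s' =>
      s'.reg r = t.eval s.view s.env ∧ s'.arr = s.arr ∧ ∀ q < r, s'.reg q = s.reg q := by
  have hupd : ∀ (s : Store) (x : ℕ), ∀ q < r, (s.setReg r x).reg q = s.reg q :=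
    fun s x q hq => Function.update_of_ne hq.ne _ _
  have hview : ∀ s s' : Store, s'.arr = s.arr → s'.view = s.view := by
    intro s s' h; unfold Store.view; rw [h]
  have henv : ∀ (s s' : Store) {r : ℕ}, 10 ≤ r → (∀ q < r, s'.reg q = s.reg q) →
      s'.env = s.env := fun s s' r hr h => funext fun i => h i (by omega)
  induction t generalizing r s with
  | const m =>
    simp only [compile, time, eval_one]
    exact .setReg ⟨by simp [Expr.eval, Term.eval], rfl, hupd _ _⟩
  | var i =>
    simp only [compile, time, eval_one]
    exact .setReg ⟨by simp [Expr.eval, Term.eval, Store.env], rfl, hupd _ _⟩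
  | cell a t ih =>
    simp only [compile, time, eval_add, eval_ofNat]
    refine (Halts.seq ((ih hr s hupd).mono le_rfl ?_)).mono le_rfl fun _ h => h
    rintro s' ⟨h1, h2, h3⟩
    refine .setReg ⟨?_, h2, fun q hq => (hupd _ _ q hq).trans (h3 q hq)⟩
    simp [Expr.eval, Term.eval, h1, h2, Store.view]
  | add t₁ t₂ ih₁ ih₂ =>
    simp only [compile, time, eval_add, eval_ofNat]
    refine (Halts.seq ((ih₁ hr s hupd).mono le_rfl ?_)).mono
      (T := _ + (t₂.time.eval (s.arr 0 0) + 1 + 1) + 1) (by omega) fun _ h => h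
    rintro s' ⟨h1, h2, h3⟩
    refine .seq ((ih₂ (r := r + 1) (by omega) s' fun s x q hq =>
      Function.update_of_ne hq.ne _ _).mono (by rw [h2]) ?_)
    rintro s'' ⟨k1, k2, k3⟩
    refine .setReg ⟨?_, k2.trans h2, fun q hq =>
      (hupd _ _ q hq).trans ((k3 q (by omega)).trans (h3 q hq))⟩
    simp [Expr.eval, Term.eval, h1, k1, k3, hview _ _ h2, henv _ _ hr h3]
  | sub t₁ t₂ ih₁ ih₂ =>
    simp only [compile, time, eval_add, eval_ofNat]
    refine (Halts.seq ((ih₁ hr s hupd).mono le_rfl ?_)).mono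
      (T := _ + (t₂.time.eval (s.arr 0 0) + 1 + 1) + 1) (by omega) fun _ h => h
    rintro s' ⟨h1, h2, h3⟩
    refine .seq ((ih₂ (r := r + 1) (by omega) s' fun s x q hq =>
      Function.update_of_ne hq.ne _ _).mono (by rw [h2]) ?_)
    rintro s'' ⟨k1, k2, k3⟩
    refine .setReg ⟨?_, k2.trans h2, fun q hq =>
      (hupd _ _ q hq).trans ((k3 q (by omega)).trans (h3 q hq))⟩
    simp [Expr.eval, Term.eval, h1, k1, k3, hview _ _ h2, henv _ _ hr h3]
  | ite t₁ t₂ t₃ t₄ ih₁ ih₂ ih₃ ih₄ =>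
    simp only [compile, time, eval_add, eval_ofNat]
    refine (Halts.seq ((ih₁ hr s hupd).mono le_rfl ?_)).mono
      (T := _ + (t₂.time.eval (s.arr 0 0) +
        (t₃.time.eval (s.arr 0 0) + t₄.time.eval (s.arr 0 0) + 1) + 1) + 1)
      (by omega) fun _ h => h
    rintro s' ⟨h1, h2, h3⟩
    refine .seq ((ih₂ (r := r + 1) (by omega) s' fun s x q hq =>
      Function.update_of_ne hq.ne _ _).mono (by rw [h2]) ?_)
    rintro s'' ⟨k1, k2, k3⟩
    have e1 : s''.arr = s.arr := k2.trans h2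
    have e2 : ∀ q < r, s''.reg q = s.reg q := fun q hq => (k3 q (by omega)).trans (h3 q hq)
    rw [hview _ _ h2, henv _ _ hr h3] at k1
    refine .ite (fun hc => (ih₃ hr s'' hupd).mono (by rw [e1]; omega) ?_)
      (fun hc => (ih₄ hr s'' hupd).mono (by rw [e1]; omega) ?_) <;>
    · simp only [Expr.eval, k1, k3 r (by omega), h1] at hc
      rintro s₃ ⟨l1, l2, l3⟩
      refine ⟨?_, l2.trans e1, fun q hq => (l3 q hq).trans (e2 q hq)⟩
      simp [l1, Term.eval, hc, hview _ _ e1, henv _ _ hr e2]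
  | sum i t ih =>
    simp only [compile, time, eval_add, eval_mul, eval_X, eval_ofNat]
    have hi := i.isLt
    refine (Halts.seq (.setReg (.seq (.setReg (Halts.seq ((Halts.forLoop
      (T := t.time.eval (s.arr 0 0) + 2) (n := s.arr 0 0)
      (Inv := fun j s' => s'.reg i = j ∧ s'.arr = s.arr ∧ s'.reg (r + 1) = s.reg i ∧
        s'.reg r = ∑ k ∈ range j, t.eval s.view (Function.update s.env i k) ∧
        ∀ q < r, q ≠ i → s'.reg q = s.reg q) ?_ ?_ ?_).mono le_rfl ?_)))))).mono
          (T := 1 + (1 + (s.arr 0 0 * (t.time.eval (s.arr 0 0) + 2 + 3) + 3 + 1 + 1) + 1) + 1)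
          (by simp only [add_assoc, Nat.reduceAdd]; omega) fun _ h => h
    · refine ⟨by simp, rfl, ?_, ?_, fun q hq hqi => ?_⟩
      · simp [Expr.eval, show r + 1 ≠ i by omega]
      · simp [Expr.eval, show r ≠ i by omega]
      · simp [hqi, hq.ne, show q ≠ r + 1 by omega]
    · exact fun j s' h => ⟨h.1, by rw [h.2.1]⟩
    · rintro j s' hj ⟨h1, h2, h3, h4, h5⟩
      refine (Halts.seq ((ih (r := r + 2) (by omega) s' fun s x q hq =>
        Function.update_of_ne hq.ne _ _).mono (by rw [h2]) ?_)).mono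
          (T := _ + 1 + 1) (by omega) fun _ h => h
      rintro s'' ⟨k1, k2, k3⟩
      have henv' : s'.env = Function.update s.env i j := by
        funext k
        by_cases hk : k = i
        · subst hk; simpa [Store.env] using h1
        · have hk' : (k : ℕ) ≠ i := fun h => hk (Fin.ext h)
          rw [Function.update_of_ne hk]
          exact h5 k (by omega) hk'
      refine .setReg ⟨?_, ?_, k2.trans h2, ?_, ?_, fun q hq hqi => ?_⟩
      · simp [show (i : ℕ) ≠ r by omega, k3 i (by omega), h1]
      · simp
      · simp [show r + 1 ≠ i by omega, k3 (r + 1) (by omega), h3]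
      · simp [show r ≠ i by omega, Expr.eval, k3 r (by omega), h4, k1,
          sum_range_succ, henv', hview _ _ h2]
      · simp [hqi, hq.ne, k3 q (by omega), h5 q hq hqi]
    · rintro s' ⟨h1, h2, h3, h4, h5⟩
      refine .setReg ⟨?_, h2, fun q hq => ?_⟩
      · simp [show r ≠ i by omega, h4, Term.eval, Store.view]
      · by_cases hqi : q = i
        · simp [hqi, Expr.eval, h3]
        · simp [hqi, h5 q hq hqi]

/-! ### Programs that tabulate terms -/

/-- Write the values that the program `P` leaves in register `r`, for all values of the registers
`0` and `1` below the first input number, into array `b`, row by row. -/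
def fill (b : ℕ) (P : Prog) (r : ℕ) : Prog :=
  -- The row offset is a sum of `n` copies of the row index, since the machine cannot multiply.
  forLoop 0 (forLoop 1 (.seq P (.seq ((Term.add (.sum 9 (.var 0)) (.var 1)).compile (r + 1))
    (.setCell b (.reg (r + 1)) (.reg r)))))

/-- The hypothesis on `P` leaves array `b` arbitrary, because part of the table has been written
when `P` runs. -/
theorem fill_spec {b : ℕ} (hb : b ≠ 0) {P : Prog} {r n : ℕ} (hr : 10 ≤ r) {s : Store}
    (hn : s.arr 0 0 = n) {T : ℕ} {f : ℕ → ℕ → ℕ}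
    (hP : ∀ i < n, ∀ j < n, ∀ s' : Store, (∀ a, a ≠ b → s'.arr a = s.arr a) →
      s'.reg 0 = i → s'.reg 1 = j → (∀ q < r, 2 ≤ q → s'.reg q = s.reg q) →
      Halts P s' T fun s'' => s''.reg r = f i j ∧ s''.arr = s'.arr ∧
        ∀ q < r, s''.reg q = s'.reg q) :
    Halts (fill b P r) s (n * (n * (T + n * 6 + 19) + 6) + 3) fun s' =>
      s'.arr = Function.update s.arr b
        (fun k => if k < n * n then f (k / n) (k % n) else s.arr b k) ∧
      ∀ q < r, 2 ≤ q → s'.reg q = s.reg q := by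
  let A : ℕ → ℕ → ℕ → ℕ := fun m => Function.update s.arr b
        (fun k => if k < m then f (k / n) (k % n) else s.arr b k)
  have hA0 : ∀ m, A m 0 0 = n := fun m => by
    simp only [A]; rw [Function.update_of_ne hb.symm, hn]
  refine (Halts.forLoop (T := n * (T + n * 6 + 19) + 3) (n := n)
    (Inv := fun i s' => s'.reg 0 = i ∧ s'.arr = A (i * n) ∧ ∀ q < r, 2 ≤ q → s'.reg q = s.reg q)
    ⟨by simp, ?_, fun q _ hq => ?_⟩ (fun j s' h => ⟨h.1, by rw [h.2.1, hA0]⟩) ?_).mono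
    (by simp only [add_assoc, Nat.reduceAdd]; omega) fun s' h => h.2
  · simp [A]
  · simp [show q ≠ 0 by omega]
  rintro i s₁ hi ⟨h1, h2, h3⟩
  refine (Halts.forLoop (T := T + n * 6 + 16) (n := n)
    (Inv := fun j s' => s'.reg 1 = j ∧ s'.reg 0 = i ∧ s'.arr = A (i * n + j) ∧
      ∀ q < r, 2 ≤ q → s'.reg q = s.reg q)
    ⟨by simp, by simpa using h1, by simpa using h2, fun q hq hq2 => ?_⟩
    (fun j s' h => ⟨h.1, by rw [h.2.2.1, hA0]⟩) ?_).mono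
    (by simp only [add_assoc, Nat.reduceAdd]; omega) ?_
  · simp [show q ≠ 1 by omega, h3 q hq hq2]
  · rintro j s₂ hj ⟨k1, k2, k3, k4⟩
    refine (Halts.seq ((hP i hi j hj s₂ ?_ k2 k1 k4).mono le_rfl ?_)).mono
      (T := T + (n * 6 + 13 + 1 + 1) + 1) (by omega) fun _ h => h
    · intro a ha
      rw [k3]
      exact Function.update_of_ne ha _ _
    rintro s₃ ⟨l1, l2, l3⟩
    refine Halts.seq (T₁ := n * 6 + 13) (T₂ := 1)
      (((Term.add (.sum 9 (.var 0)) (.var 1)).compile_spec (r := r + 1) (by omega) s₃).mono ?_ ?_)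
    · rw [l2, k3, hA0]
      simp only [Term.time, eval_add, eval_mul, eval_X, eval_one, eval_ofNat]
      omega
    rintro s₄ ⟨m1, m2, m3⟩
    have hidx : s₄.reg (r + 1) = i * n + j := by
      rw [m1]
      have e0 : s₃.view 0 0 = n := by simp only [Store.view, l2, k3]; exact hA0 _
      have e1 : s₃.reg 0 = i := by rw [l3 0 (by omega), k2]
      have e2 : s₃.reg 1 = j := by rw [l3 1 (by omega), k1]
      simp [Term.eval, Store.env, e0, e1, e2, mul_comm]
    have hkeep : ∀ q < r, s₄.reg q = s₂.reg q := fun q hq =>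
      (m3 q (by omega)).trans (l3 q hq)
    refine .setCell ⟨?_, by simp, ?_, ?_, fun q hq hq2 => ?_⟩
    · simp [hkeep 1 (by omega), k1]
    · simp [hkeep 0 (by omega), k2]
    · have hn0 : 0 < n := by omega
      simp only [Store.setReg_arr, Store.setCell_arr, Expr.eval, hidx, m3 r (by omega), l1, m2, l2,
        k3, A, Function.update_idem, Function.update_self, ← add_assoc]
      congr 1
      funext k
      by_cases hk : k = i * n + j
      · subst hk
        simp [mul_comm i n, Nat.mul_add_div hn0,
          Nat.div_eq_of_lt hj, Nat.mod_eq_of_lt hj]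
      · rw [Function.update_of_ne hk]
        have : k < i * n + j + 1 ↔ k < i * n + j := by omega
        simp [this]
    · simp [show q ≠ 1 by omega, hkeep q hq, k4 q hq hq2]
  · rintro s' ⟨k1, k2, k3, k4⟩
    refine ⟨k2, by simp, ?_, fun q hq hq2 => ?_⟩
    · simp [k3, Nat.succ_mul]
    · simp [show q ≠ 0 by omega, k4 q hq hq2]

/-- Programs that tabulate terms with the free variables `0` and `1` as square matrices. The
matrices are stored in the arrays `1, 2, …` of the terms. -/
inductive Tabulation where
  | table (a : ℕ) (t : Term)
  | seq (P Q : Tabulation)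
  | rep (P : Tabulation)

/-- The assignment of `i` and `j` to the first two variables. -/
def pairEnv (i j : ℕ) : Fin 10 → ℕ := fun k => if k = 0 then i else if k = 1 then j else 0

/-- The arrays after a tabulation. A table is row by row a square matrix, and `rep` repeats a
tabulation as often as the first input number says. -/
def Tabulation.run : Tabulation → (ℕ → ℕ → ℕ) → ℕ → ℕ → ℕ
  | .table a t, σ => Function.update σ (a + 1) fun k =>
      if k < σ 0 0 * σ 0 0 then t.eval σ (pairEnv (k / σ 0 0) (k % σ 0 0)) else σ (a + 1) k
  | .seq P Q, σ => Q.run (P.run σ)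
  | .rep P, σ => P.run^[σ 0 0] σ

theorem Tabulation.run_zero (P : Tabulation) (σ : ℕ → ℕ → ℕ) : P.run σ 0 = σ 0 := by
  induction P generalizing σ with
  | table a t => exact Function.update_of_ne (by omega) _ _
  | seq P Q ihP ihQ => exact (ihQ _).trans (ihP _)
  | rep P ih =>
    rw [run]
    generalize σ 0 0 = m
    induction m with
    | zero => rfl
    | succ m ihm => rw [Function.iterate_succ_apply', ih, ihm]

/-- The compiled tabulation. It keeps the registers from `2` to `r - 1`. Array `1` is a buffer. -/
def Tabulation.compile : Tabulation → ℕ → Prog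
  -- The term may read the array that is being replaced, so the table is built in array `1`,
  -- invisible to terms as its index is odd, and then copied.
  | .table a t, r => .seq (fill 1 (t.compile r) r) (fill (2 * (a + 1))
      (.seq ((Term.add (.sum 9 (.var 0)) (.var 1)).compile r) (.setReg r (.cell 1 (.reg r)))) r)
  | .seq P Q, r => .seq (P.compile r) (Q.compile r)
  | .rep P, r => forLoop r (P.compile (r + 1))

/-- A bound on the running time of the compiled tabulation. -/
noncomputable def Tabulation.time : Tabulation → ℕ[X]
  | .table _ t => (X * (X * (t.time + X * 6 + 19) + 6) + 3) +
      (X * (X * (X * 6 + 15 + X * 6 + 19) + 6) + 3) + 1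
  | .seq P Q => P.time + Q.time + 1
  | .rep P => X * (P.time + 3) + 3

theorem Tabulation.compile_spec (P : Tabulation) {r : ℕ} (hr : 10 ≤ r) (s : Store)
    (hs : ∀ q < 10, 2 ≤ q → s.reg q = 0) :
    Halts (P.compile r) s (P.time.eval (s.arr 0 0)) fun s' =>
      s'.view = P.run s.view ∧ ∀ q < r, 2 ≤ q → s'.reg q = s.reg q := by
  induction P generalizing r s with
  | table a t =>
    obtain ⟨n, hn⟩ : ∃ n, s.arr 0 0 = n := ⟨_, rfl⟩
    simp only [compile, time, eval_add, eval_mul, eval_X, eval_ofNat, eval_one, hn]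
    have hview : ∀ s' : Store, (∀ a, a ≠ 1 → s'.arr a = s.arr a) → s'.view = s.view :=
      fun s' h => funext fun a => h _ (by omega)
    refine .seq ((fill_spec one_ne_zero hr hn (T := t.time.eval n)
      (f := fun i j => t.eval s.view (pairEnv i j)) ?_).mono le_rfl ?_)
    · intro i hi j hj s' h1 h2 h3 h4
      refine (t.compile_spec hr s').mono (by rw [h1 0 (by omega), hn]) ?_
      rintro s'' ⟨k1, k2, k3⟩
      refine ⟨?_, k2, k3⟩
      rw [k1, hview s' h1]
      congr 1
      funext k
      unfold Store.env pairEnv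
      split_ifs with e1 e2
      · rw [e1]; exact h2
      · rw [e2]; exact h3
      · have : 2 ≤ (k : ℕ) := by
          have e1' : (k : ℕ) ≠ 0 := fun h => e1 (Fin.ext h)
          have e2' : (k : ℕ) ≠ 1 := fun h => e2 (Fin.ext h)
          omega
        rw [h4 k (by omega) this, hs k (by omega) this]
    rintro s₁ ⟨h1, h2⟩
    have hn1 : s₁.arr 0 0 = n := by rw [h1, Function.update_of_ne (by omega), hn]
    refine (fill_spec (b := 2 * (a + 1)) (by omega) hr hn1 (T := n * 6 + 15)
      (f := fun i j => t.eval s.view (pairEnv i j)) ?_).mono le_rfl ?_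
    · intro i hi j hj s' k1 k2 k3 k4
      refine (Halts.seq (((Term.add (.sum 9 (.var 0)) (.var 1)).compile_spec hr s').mono
        (T' := n * 6 + 13) ?_ ?_)).mono (T := n * 6 + 13 + 1 + 1) (by omega) fun _ h => h
      · rw [k1 0 (by omega), hn1]; simp [Term.time]
      rintro s'' ⟨l1, l2, l3⟩
      have hidx : s''.reg r = i * n + j := by
        rw [l1]
        have e0 : s'.view 0 0 = n := by
          simp only [Store.view]
          rw [k1 _ (by omega), hn1]
        simp [Term.eval, Store.env, e0, k2, k3, mul_comm]
      refine .setReg ⟨?_, l2, fun q hq => ?_⟩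
      · have hlt : i * n + j < n * n := by
          calc i * n + j < i * n + n := by omega
            _ = (i + 1) * n := by ring
            _ ≤ n * n := Nat.mul_le_mul_right n hi
        have hn0 : 0 < n := by omega
        simp only [Store.setReg_reg, Function.update_self, Expr.eval, hidx]
        rw [l2, k1 1 (by omega), h1, Function.update_self, if_pos hlt, mul_comm i n,
          Nat.mul_add_div hn0, Nat.mul_add_mod, Nat.div_eq_of_lt hj, Nat.mod_eq_of_lt hj, add_zero]
      · simp [hq.ne, l3 q hq]
    rintro s₂ ⟨k1, k2⟩
    refine ⟨?_, fun q hq hq2 => (k2 q hq hq2).trans (h2 q hq hq2)⟩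
    have hv0 : s.view 0 0 = n := hn
    funext b
    simp only [Store.view, run]
    rw [k1]
    by_cases hba : b = a + 1
    · subst hba
      rw [Function.update_self, Function.update_self, h1, Function.update_of_ne (by omega)]
      change _ = fun k => if k < s.view 0 0 * s.view 0 0 then _ else _
      rw [hv0]
      simp only [show s.arr (2 * 0) 0 = n from hn]
    · rw [Function.update_of_ne (by omega), Function.update_of_ne hba, h1,
        Function.update_of_ne (by omega)]
      rfl
  | seq P Q ihP ihQ =>
    simp only [compile, time, eval_add, eval_one]
    refine .seq ((ihP hr s hs).mono le_rfl ?_)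
    rintro s' ⟨h1, h2⟩
    have h0 : s'.arr 0 = s.arr 0 := by
      have := congrFun h1 0
      rwa [P.run_zero] at this
    refine (ihQ hr s' fun q hq hq2 => ?_).mono (by rw [h0]) ?_
    · rw [h2 q (by omega) hq2, hs q hq hq2]
    · rintro s'' ⟨k1, k2⟩
      exact ⟨by rw [k1, h1, run], fun q hq hq2 => (k2 q hq hq2).trans (h2 q hq hq2)⟩
  | rep P ih =>
    obtain ⟨n, hn⟩ : ∃ n, s.arr 0 0 = n := ⟨_, rfl⟩
    simp only [compile, time, eval_add, eval_mul, eval_X, eval_ofNat, hn]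
    have hv0 : ∀ m, P.run^[m] s.view 0 = s.view 0 := by
      intro m
      induction m with
      | zero => rfl
      | succ m ihm => rw [Function.iterate_succ_apply', P.run_zero, ihm]
    have harr : ∀ (s' : Store) m, s'.view = P.run^[m] s.view → s'.arr 0 0 = n := by
      intro s' m h
      have := congrFun (congrFun h 0) 0
      rw [hv0] at this
      exact this.trans hn
    refine (Halts.forLoop (n := n) (Inv := fun j s' => s'.reg r = j ∧
      s'.view = P.run^[j] s.view ∧ ∀ q < r, 2 ≤ q → s'.reg q = s.reg q)
      ⟨by simp, rfl, fun q hq _ => by simp [hq.ne]⟩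
      (fun j s' h => ⟨h.1, harr s' j h.2.1⟩) ?_).mono le_rfl ?_
    · rintro j s' hj ⟨h1, h2, h3⟩
      refine (ih (r := r + 1) (by omega) s' fun q hq hq2 => ?_).mono
        (by rw [harr s' j h2]) ?_
      · rw [h3 q (by omega) hq2, hs q hq hq2]
      · rintro s'' ⟨k1, k2⟩
        refine ⟨(k2 r (by omega) (by omega)).trans h1, by simp, ?_, fun q hq hq2 => ?_⟩
        · rw [Function.iterate_succ_apply', ← h2]
          exact k1
        · simp [hq.ne, k2 q (by omega) hq2, h3 q hq hq2]
    · rintro s' ⟨-, h2, h3⟩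
      refine ⟨?_, h3⟩
      rw [run, h2]
      change _ = P.run^[s.arr 0 0] s.view
      rw [hn]

/-! ### Decision procedures -/

theorem eval_mono_of_le (p : ℕ[X]) {m n : ℕ} (h : m ≤ n) : p.eval m ≤ p.eval n := by
  rw [eval_eq_sum, eval_eq_sum]
  exact Finset.sum_le_sum fun i _ => Nat.mul_le_mul_left _ (Nat.pow_le_pow_left h i)

/-- The arrays that hold an input word. -/
def inputArrays (w : List ℕ) : ℕ → ℕ → ℕ := fun a i => if a = 0 then w.getD i 0 else 0

/-- A problem is solvable in polynomial time if it is decided by a tabulation and a term. -/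
theorem solvableInPolyTime_of_tabulation {α : Type} {enc : α → List ℕ} {promise yes : α → Prop}
    (P : Tabulation) (t : Term) (hn : ∀ x, (enc x).getD 0 0 ≤ inputSize (enc x))
    (hyes : ∀ x, promise x → yes x → t.eval (P.run (inputArrays (enc x))) (fun _ => 0) = 1)
    (hno : ∀ x, promise x → ¬ yes x → t.eval (P.run (inputArrays (enc x))) (fun _ => 0) = 0) :
    SolvableInPolyTime enc promise yes := by
  -- The tabulation uses the registers `0` and `1` as counters; the other variables are still `0`.
  refine ⟨.seq (P.compile 10) (.seq (.setReg 0 (.const 0)) (.seq (.setReg 1 (.const 0))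
    (.seq (t.compile 10) (.setReg 0 (.reg 10))))), P.time + t.time + 7, fun x hx => ?_⟩
  set s := initStore (enc x) with hs
  have hview : s.view = inputArrays (enc x) := by
    funext a i
    simp [Store.view, hs, initStore, inputArrays]
  have h0 : s.arr 0 0 = (enc x).getD 0 0 := rfl
  have key : Halts (.seq (P.compile 10) (.seq (.setReg 0 (.const 0)) (.seq (.setReg 1 (.const 0))
      (.seq (t.compile 10) (.setReg 0 (.reg 10)))))) s ((P.time + t.time + 7).eval (s.arr 0 0))
      fun s' => s'.reg 0 = t.eval (P.run (inputArrays (enc x))) (fun _ => 0) := by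
    refine (Halts.seq ((P.compile_spec le_rfl s fun _ _ _ => rfl).mono le_rfl ?_)).mono
      (T := P.time.eval (s.arr 0 0) + (1 + (1 + (t.time.eval (s.arr 0 0) + 1 + 1) + 1) + 1) + 1)
      (by simp only [eval_add, eval_ofNat]; omega) fun _ h => h
    rintro s₁ ⟨h1, h2⟩
    refine .seq (.setReg (.seq (.setReg (.seq ((t.compile_spec le_rfl _).mono ?_ ?_)))))
    · have := congrFun (congrFun h1 0) 0
      rw [P.run_zero] at this
      exact (congrArg (fun m => t.time.eval m) this).le
    rintro s₂ ⟨k1, -, -⟩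
    refine .setReg ?_
    simp only [Store.setReg_reg, Function.update_self, Expr.eval, k1]
    have e1 : ∀ a b, ((s₁.setReg 0 a).setReg 1 b).view = P.run (inputArrays (enc x)) := by
      intro a b
      rw [← hview, ← h1]
      rfl
    have e2 : ((s₁.setReg 0 0).setReg 1 0).env = fun _ => 0 := by
      funext k
      simp only [Store.env, Store.setReg_reg, Function.update_apply]
      split_ifs with e1 e2
      · rfl
      · rfl
      · rw [h2 k (by omega) (by omega)]
        rfl
    rw [e1, e2]
  obtain ⟨T, hT, s', hrun, hres⟩ := key
  refine ⟨T, hT.trans (eval_mono_of_le _ (h0 ▸ hn x)), s', hrun [], fun h => ?_, fun h => ?_⟩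
  · rw [hres, hyes x hx h]
  · rw [hres, hno x hx h]

end Compiler

/-! ### The criterion as tables of least fixed points, and the decision procedure. -/

section Algorithm

open Finset

/-! ### Logical terms

A term counts as true if its value is positive: sums are existential quantifiers and additions are
disjunctions. -/

namespace Term

/-- Conjunction. -/
def and (a b : Term) : Term := .ite (.const 0) a b (.const 0)

/-- Negation. -/
def not (a : Term) : Term := .sub (.const 1) a

/-- Equality. -/
def eq (a b : Term) : Term := .not (.add (.sub a b) (.sub b a))

/-- The entry of a square matrix in the row `i` (which must not use the variable `9`). -/
def entry (a : ℕ) (i j : Term) : Term := .cell a (.add (.sum 9 i) j)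

/-- The start node of the input. -/
def start : Term := .cell 0 (.const 2)

/-- The color of a node. -/
def col (v : Term) : Term := .cell 0 (.add (.const 4) v)

/-- Adjacency of a node `u` (not using the variable `9`) to a node `v`. -/
def adj (u v : Term) : Term :=
  .cell 0 (.add (.add (.const 4) (.cell 0 (.const 0))) (.add (.sum 9 u) v))

variable {σ : ℕ → ℕ → ℕ} {ρ : Fin 10 → ℕ}

theorem pos_and {a b : Term} :
    0 < (and a b).eval σ ρ ↔ 0 < a.eval σ ρ ∧ 0 < b.eval σ ρ := by
  simp only [and, eval]
  split_ifs with h <;> simp [h]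

theorem pos_not {a : Term} : 0 < (not a).eval σ ρ ↔ ¬ 0 < a.eval σ ρ := by
  simp only [not, eval]
  omega

theorem pos_eq {a b : Term} : 0 < (eq a b).eval σ ρ ↔ a.eval σ ρ = b.eval σ ρ := by
  simp only [eq, not, eval]
  omega

theorem pos_add {a b : Term} :
    0 < (add a b).eval σ ρ ↔ 0 < a.eval σ ρ ∨ 0 < b.eval σ ρ := by
  simp only [eval]
  omega

theorem pos_sub {a b : Term} :
    0 < (sub a b).eval σ ρ ↔ b.eval σ ρ < a.eval σ ρ := by
  simp only [eval]
  omega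

theorem pos_sum {n : ℕ} (hn : σ 0 0 = n) {i : Fin 10} {a : Term} :
    0 < (sum i a).eval σ ρ ↔ ∃ k : Fin n, 0 < a.eval σ (Function.update ρ i k) := by
  simp only [eval, hn, Finset.sum_pos_iff, mem_range, Fin.exists_iff, exists_prop]

end Term

theorem pairEnv_zero (i j : ℕ) : pairEnv i j 0 = i := rfl

theorem pairEnv_one (i j : ℕ) : pairEnv i j 1 = j := rfl

/-! ### Closures -/

/-- Until it is stationary, the iterate gains an element in each round. -/
theorem iterate_eq_of_subset {α : Type*} [Finite α] {F : Set α → Set α} (hF : ∀ S, S ⊆ F S)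
    {N : ℕ} (hN : Nat.card α ≤ N) (S : Set α) : F (F^[N] S) = F^[N] S := by
  by_contra hne
  have hne' : ∀ m ≤ N, F (F^[m] S) ≠ F^[m] S := by
    intro m hm h
    refine hne ?_
    obtain ⟨k, rfl⟩ := Nat.exists_eq_add_of_le' hm
    rw [Function.iterate_add_apply, Function.iterate_fixed h]
    exact h
  have hcard : ∀ m ≤ N + 1, m ≤ (F^[m] S).ncard := by
    intro m
    induction m with
    | zero => intro; omega
    | succ m ih =>
      intro hm
      have := Set.ncard_lt_ncard ((hF (F^[m] S)).ssubset_of_ne (hne' m (by omega)).symm)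
        (Set.toFinite _)
      rw [Function.iterate_succ_apply']
      have := ih (by omega)
      omega
  have h1 := hcard (N + 1) le_rfl
  have h2 := Set.ncard_le_card (F^[N + 1] S)
  omega

theorem index_lt {n : ℕ} (i j : Fin n) : n * i + j < n * n := by
  calc n * i + j < n * i + n := by omega
    _ = n * (i + 1) := by ring
    _ ≤ n * n := Nat.mul_le_mul_left n i.isLt

/-- The relation that is stored in an array as a square matrix. -/
def stored (n : ℕ) (σ : ℕ → ℕ → ℕ) (a : ℕ) : Set (Fin n × Fin n) :=
  {p | 0 < σ a (n * p.1 + p.2)}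

theorem stored_congr {n : ℕ} {σ σ' : ℕ → ℕ → ℕ} {a : ℕ} (h : σ' a = σ a) :
    stored n σ' a = stored n σ a := by
  simp only [stored, h]

theorem run_table_of_ne {a b : ℕ} (h : b ≠ a + 1) (t : Term) (σ : ℕ → ℕ → ℕ) :
    (Tabulation.table a t).run σ b = σ b := Function.update_of_ne h _ _

theorem stored_run_table {n : ℕ} {σ : ℕ → ℕ → ℕ} (hn : σ 0 0 = n) (a : ℕ) (t : Term) :
    stored n ((Tabulation.table a t).run σ) (a + 1) =
      {p | 0 < t.eval σ (pairEnv p.1 p.2)} := by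
  ext ⟨i, j⟩
  have hlt := index_lt i j
  have hn0 : 0 < n := by have := i.isLt; omega
  simp only [stored, Tabulation.run, Function.update_self, Set.mem_ofPred_eq, hn, if_pos hlt,
    Nat.mul_add_div hn0, Nat.mul_add_mod, Nat.div_eq_of_lt j.isLt, Nat.mod_eq_of_lt j.isLt,
    add_zero]

/-- Tabulate the closure of the relation `t₀` under the rule `t₁`. -/
def Tabulation.closure (a : ℕ) (t₀ t₁ : Term) : Tabulation :=
  -- The nested repetition gives `n * n` rounds, one for each pair of nodes.
  .seq (.table a t₀) (.rep (.rep (.table a (.add (.entry (a + 1) (.var 0) (.var 1)) t₁))))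

theorem eval_entry {n : ℕ} {σ : ℕ → ℕ → ℕ} (hn : σ 0 0 = n) (a : ℕ) (i : Fin 10) (hi : i ≠ 9)
    (t : Term) (ρ : Fin 10 → ℕ) :
    (Term.entry a (.var i) t).eval σ ρ = σ a (n * ρ i + t.eval σ ρ) := by
  simp [Term.entry, Term.eval, hn, Function.update_of_ne hi]

theorem pos_entry {n : ℕ} {σ : ℕ → ℕ → ℕ} (hn : σ 0 0 = n) {a : ℕ} {i j : Fin 10} (hi : i ≠ 9)
    {ρ : Fin 10 → ℕ} {k l : Fin n} (hk : ρ i = k) (hl : ρ j = l) :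
    0 < (Term.entry a (.var i) (.var j)).eval σ ρ ↔ (k, l) ∈ stored n σ a := by
  rw [eval_entry hn a i hi, stored, Term.eval, hk, hl]
  rfl

/-- All iterates of `S ∪ F S` stay in `T` by `hbase` and `hclosed`; the last one is closed under `F`
and hence contains `T` by `hleast`. The rule is evaluated in stores `τ` in which the table is only
partly built. -/
theorem closure_spec {n : ℕ} {σ : ℕ → ℕ → ℕ} (hn : σ 0 0 = n) {a : ℕ} {t₀ t₁ : Term}
    {S₀ T : Set (Fin n × Fin n)} {F : Set (Fin n × Fin n) → Set (Fin n × Fin n)}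
    (h₀ : ∀ i j : Fin n, 0 < t₀.eval σ (pairEnv i j) ↔ (i, j) ∈ S₀)
    (h₁ : ∀ τ : ℕ → ℕ → ℕ, (∀ b, b ≠ a + 1 → τ b = σ b) → ∀ i j : Fin n,
      0 < t₁.eval τ (pairEnv i j) ↔ (i, j) ∈ F (stored n τ (a + 1)))
    (hbase : S₀ ⊆ T) (hclosed : ∀ S ⊆ T, F S ⊆ T) (hleast : ∀ S, S₀ ⊆ S → F S ⊆ S → T ⊆ S) :
    (∀ b, b ≠ a + 1 → (Tabulation.closure a t₀ t₁).run σ b = σ b) ∧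
      stored n ((Tabulation.closure a t₀ t₁).run σ) (a + 1) = T := by
  set step : Tabulation := .table a (.add (.entry (a + 1) (.var 0) (.var 1)) t₁) with hstep
  set σ₁ := (Tabulation.table a t₀).run σ with hσ₁
  have hne : ∀ m b, b ≠ a + 1 → step.run^[m] σ₁ b = σ b := by
    intro m b hb
    induction m with
    | zero => exact run_table_of_ne hb _ _
    | succ m ih => rw [Function.iterate_succ_apply', hstep, run_table_of_ne hb, ← hstep, ih]
  have hn' : ∀ m, step.run^[m] σ₁ 0 0 = n := fun m => by rw [hne m 0 (by omega), hn]
  have hrun : (Tabulation.closure a t₀ t₁).run σ = step.run^[n * n] σ₁ := by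
    have h1 : ∀ m, (Tabulation.rep step).run^[m] σ₁ = step.run^[n * m] σ₁ := by
      intro m
      induction m with
      | zero => rfl
      | succ m ih =>
        rw [Function.iterate_succ_apply', ih, Tabulation.run, hn', ← Function.iterate_add_apply]
        rw [Nat.mul_succ, add_comm]
    change (Tabulation.rep step).run^[σ₁ 0 0] σ₁ = _
    rw [show σ₁ 0 0 = n from hn' 0, h1]
  have hS : ∀ m, stored n (step.run^[m] σ₁) (a + 1) = (fun S => S ∪ F S)^[m] S₀ := by
    intro m
    induction m with
    | zero =>
      refine (stored_run_table hn a t₀).trans (Set.ext fun p => h₀ p.1 p.2)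
    | succ m ih =>
      rw [Function.iterate_succ_apply', Function.iterate_succ_apply', ← ih, hstep,
        stored_run_table (hn' m), ← hstep]
      ext ⟨i, j⟩
      rw [Set.mem_ofPred_eq, Term.pos_add, h₁ _ (hne m),
        pos_entry (hn' m) (by decide) (pairEnv_zero ..) (pairEnv_one ..), Set.mem_union]
  refine ⟨fun b hb => by rw [hrun, hne _ b hb], ?_⟩
  rw [hrun, hS]
  refine Set.Subset.antisymm ?_ (hleast _ ?_ ?_)
  · generalize n * n = m
    induction m with
    | zero => exact hbase
    | succ m ih =>
      rw [Function.iterate_succ_apply']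
      exact Set.union_subset ih (hclosed _ ih)
  · generalize n * n = m
    induction m with
    | zero => exact subset_rfl
    | succ m ih =>
      rw [Function.iterate_succ_apply']
      exact ih.trans Set.subset_union_left
  · have := iterate_eq_of_subset (F := fun S => S ∪ F S) (fun S => Set.subset_union_left)
      (N := n * n) (by simp) S₀
    exact Set.subset_union_right.trans this.subset

/-! ### The input -/

/-- The input arrays contain the instance. -/
structure IsInput (I : Instance) (σ : ℕ → ℕ → ℕ) : Prop where
  size : σ 0 0 = I.n
  start : σ 0 2 = I.start
  bound : σ 0 3 = I.bound
  col : ∀ v : Fin I.n, σ 0 (4 + v) = I.col v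
  adj : ∀ u v : Fin I.n, 0 < σ 0 (4 + I.n + (I.n * u + v)) ↔ I.graph.Adj u v

theorem IsInput.congr {I : Instance} {σ τ : ℕ → ℕ → ℕ} (h : IsInput I σ) (hτ : τ 0 = σ 0) :
    IsInput I τ := by
  obtain ⟨h1, h2, h3, h4, h5⟩ := h
  constructor <;> rw [hτ] <;> assumption

theorem getElem?_flatten_ofFn {n : ℕ} (f : Fin n → Fin n → ℕ) (u v : Fin n) :
    (List.ofFn fun i => List.ofFn fun j => f i j).flatten[n * u + v]? = some (f u v) := by
  have hn0 : 0 < n := by have := u.isLt; omega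
  have hlt := index_lt u v
  have h := List.ofFn_mul' (m := n) (n := n) fun k : Fin (n * n) =>
    f ⟨k / n, Nat.div_lt_of_lt_mul k.isLt⟩ ⟨k % n, Nat.mod_lt _ hn0⟩
  simp only [Nat.mul_add_div hn0, Nat.mul_add_mod, Fin.is_lt, Nat.div_eq_of_lt, Nat.mod_eq_of_lt,
    add_zero, Fin.eta] at h
  rw [← h, List.getElem?_ofFn, dif_pos hlt]
  simp [Nat.mul_add_div hn0, Nat.div_eq_of_lt v.isLt, Nat.mod_eq_of_lt v.isLt]

theorem isInput_inputArrays (I : Instance) : IsInput I (inputArrays I.encode) := by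
  have h : inputArrays I.encode 0 = fun i => I.encode.getD i 0 := by
    funext i; simp [inputArrays]
  constructor <;> rw [h]
  · simp [Instance.encode]
  · simp [Instance.encode]
  · simp [Instance.encode]
  · intro v
    have hv := v.isLt
    simp [Instance.encode, List.getD_eq_getElem?_getD, List.getElem?_append, add_comm 4]
  · intro u v
    have hlen : ([I.n, I.k, (I.start : ℕ), I.bound] ++
        List.ofFn fun i => (I.col i : ℕ)).length = 4 + I.n := by
      simp only [List.length_append, List.length_cons, List.length_nil, List.length_ofFn]
    change 0 < I.encode.getD _ 0 ↔ _
    rw [Instance.encode, List.getD_eq_getElem?_getD, List.getElem?_append_right (by omega), hlen,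
      Nat.add_sub_cancel_left, getElem?_flatten_ofFn, Option.getD_some]
    split_ifs with hadj <;> simp [hadj]

theorem getD_encode_le (I : Instance) : I.encode.getD 0 0 ≤ inputSize I.encode := by
  have h1 : I.encode.getD 0 0 = I.n := by simp [Instance.encode]
  have h2 : I.n ≤ I.encode.length := by
    simp only [Instance.encode, List.length_append, List.length_ofFn]
    omega
  have h3 : ∀ w : List ℕ, w.length ≤ inputSize w := by
    intro w
    induction w with
    | nil => simp
    | cons m w ih => simp [inputSize] at ih ⊢; omega
  rw [h1]
  exact h2.trans (h3 _)

variable {I : Instance} {σ : ℕ → ℕ → ℕ} {ρ : Fin 10 → ℕ}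

theorem IsInput.pos_adj (h : IsInput I σ) {i j : Fin 10} (hi : i ≠ 9) {u v : Fin I.n}
    (hu : ρ i = u) (hv : ρ j = v) :
    0 < (Term.adj (.var i) (.var j)).eval σ ρ ↔ I.graph.Adj u v := by
  rw [← h.adj]
  simp [Term.adj, Term.eval, h.size, Function.update_of_ne hi, hu, hv]

theorem IsInput.pos_eq_col (h : IsInput I σ) {i j : Fin 10} {u v : Fin I.n}
    (hu : ρ i = u) (hv : ρ j = v) :
    0 < (Term.eq (.col (.var i)) (.col (.var j))).eval σ ρ ↔ I.col u = I.col v := by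
  rw [Term.pos_eq]
  simp only [Term.col, Term.eval, hu, hv, h.col]
  exact Fin.val_inj

theorem IsInput.pos_eq_start (h : IsInput I σ) {i : Fin 10} {u : Fin I.n} (hu : ρ i = u) :
    0 < (Term.eq (.var i) .start).eval σ ρ ↔ u = I.start := by
  rw [Term.pos_eq]
  simp only [Term.start, Term.eval, hu, h.start]
  exact Fin.val_inj

theorem pos_eq_var {n : ℕ} {i j : Fin 10} {u v : Fin n} (hu : ρ i = u) (hv : ρ j = v) :
    0 < (Term.eq (.var i) (.var j)).eval σ ρ ↔ u = v := by
  rw [Term.pos_eq]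
  simp only [Term.eval, hu, hv]
  exact Fin.val_inj

/-! ### The tables of the algorithm -/

/-- The pairs `(x, u)` such that `x` is conquered from `u` by one move. -/
def nbhdRel (I : Instance) : Set (Fin I.n × Fin I.n) :=
  {p | p.1 ∈ colorNbhd I.graph I.col p.2 (I.col p.1)}

/-- The pairs `(x, v)` such that `x` does not separate the start node from `v`. -/
def avoidRel (I : Instance) : Set (Fin I.n × Fin I.n) :=
  {p | ¬ Separates I.graph I.col I.start p.1 p.2}

/-- The pairs `(u, v)` such that the step from `u` to `v` is free. -/
def freeRel (I : Instance) : Set (Fin I.n × Fin I.n) :=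
  {p | I.col p.1 = I.col p.2 ∧ p.1 ≠ I.start ∨ IsFinisher I.graph I.col I.start p.2}

/-- The pairs `(d, v)` such that `v` is reached at cost `d`. -/
def reachRel (I : Instance) : Set (Fin I.n × Fin I.n) :=
  {p | Reach I.graph I.col I.start (IsFinisher I.graph I.col I.start) p.1 p.2}

/-- The table of `nbhdRel`, in array `1`. -/
def nbhdTable : Tabulation :=
  .closure 0 (.eq (.var 0) (.var 1))
    (.sum 2 (.and (.adj (.var 1) (.var 2)) (.and (.eq (.col (.var 2)) (.col (.var 0)))
      (.entry 1 (.var 0) (.var 2)))))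

theorem nbhdTable_spec (h : IsInput I σ) :
    (∀ b, b ≠ 1 → nbhdTable.run σ b = σ b) ∧ stored I.n (nbhdTable.run σ) 1 = nbhdRel I := by
  refine closure_spec (n := I.n) h.size (S₀ := {p | p.1 = p.2})
    (F := fun S => {p | ∃ w, I.graph.Adj p.2 w ∧ I.col w = I.col p.1 ∧ (p.1, w) ∈ S}) ?_ ?_ ?_ ?_ ?_
  · exact fun i j => pos_eq_var rfl rfl
  · intro τ hτ i j
    have hI := h.congr (hτ 0 (by decide))
    rw [Term.pos_sum hI.size]
    refine exists_congr fun w => ?_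
    rw [Term.pos_and, Term.pos_and, hI.pos_adj (u := j) (v := w) (by decide) rfl rfl,
      hI.pos_eq_col (u := w) (v := i) rfl rfl,
      pos_entry hI.size (k := i) (l := w) (by decide) rfl rfl]
  · rintro ⟨x, u⟩ (rfl : x = u)
    exact mem_colorNbhd_self ..
  · rintro S hS ⟨x, u⟩ ⟨w, h1, h2, h3⟩
    exact mem_colorNbhd_cons h1 h2 (hS h3)
  · rintro S h0 h1 ⟨x, u⟩ ⟨-, p, hp⟩
    replace hp : ∀ y ∈ p.support.tail, I.col y = I.col x := hp
    change (x, u) ∈ S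
    change I.graph.Walk u x at p
    induction p with
    | nil => exact h0 rfl
    | cons hadj p ih =>
      rw [SimpleGraph.Walk.support_cons, List.tail_cons] at hp
      exact h1 ⟨_, hadj, hp _ p.start_mem_support, ih fun y hy => hp y (List.mem_of_mem_tail hy)⟩

/-- The table of `avoidRel`, in array `2`. -/
def avoidTable : Tabulation :=
  .closure 1 (.and (.eq (.var 1) .start) (.not (.entry 1 (.var 0) (.var 1))))
    (.and (.not (.entry 1 (.var 0) (.var 1)))
      (.sum 2 (.and (.adj (.var 2) (.var 1)) (.entry 2 (.var 0) (.var 2)))))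

/-- Separation speaks about all walks, but its negation is reachability: some walk from the start
avoids every node from which `x` is conquered by one move. -/
theorem avoidTable_spec (h : IsInput I σ) (h₁ : stored I.n σ 1 = nbhdRel I) :
    (∀ b, b ≠ 2 → avoidTable.run σ b = σ b) ∧ stored I.n (avoidTable.run σ) 2 = avoidRel I := by
  refine closure_spec (n := I.n) h.size
    (S₀ := {p | p.2 = I.start ∧ p ∉ nbhdRel I})
    (F := fun S => {p | p ∉ nbhdRel I ∧ ∃ w, I.graph.Adj w p.2 ∧ (p.1, w) ∈ S}) ?_ ?_ ?_ ?_ ?_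
  · intro i j
    rw [Term.pos_and, Term.pos_not, h.pos_eq_start (u := j) rfl,
      pos_entry h.size (k := i) (l := j) (by decide) rfl rfl, h₁]
    rfl
  · intro τ hτ i j
    have hI := h.congr (hτ 0 (by decide))
    rw [Term.pos_and, Term.pos_not, pos_entry hI.size (k := i) (l := j) (by decide) rfl rfl,
      stored_congr (hτ 1 (by decide)), h₁, Term.pos_sum hI.size]
    refine and_congr Iff.rfl (exists_congr fun w => ?_)
    rw [Term.pos_and, hI.pos_adj (u := w) (v := j) (by decide) rfl rfl,
      pos_entry hI.size (k := i) (l := w) (by decide) rfl rfl]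
  · rintro ⟨x, v⟩ ⟨rfl : v = I.start, h2⟩ hsep
    obtain ⟨u, hu, h3⟩ := hsep .nil
    rw [SimpleGraph.Walk.support_nil, List.mem_singleton] at hu
    exact h2 (hu ▸ h3)
  · rintro S hS ⟨x, v⟩ ⟨h1, w, h2, h3⟩ hsep
    refine hS h3 fun p => ?_
    obtain ⟨u, hu, hxu⟩ := hsep (p.concat h2)
    rw [SimpleGraph.Walk.support_concat, List.mem_append, List.mem_singleton] at hu
    rcases hu with hu | rfl
    · exact ⟨u, hu, hxu⟩
    · exact absurd hxu h1
  · rintro S h0 h1 ⟨x, v⟩ hx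
    simp only [avoidRel, Separates, Set.mem_ofPred_eq, not_forall, not_exists, not_and] at hx
    obtain ⟨p, hp⟩ := hx
    have key : ∀ (s v : Fin I.n) (p : I.graph.Walk s v), (x, s) ∈ S →
        (∀ u ∈ p.support, (x, u) ∉ nbhdRel I) → (x, v) ∈ S := by
      intro s v p
      induction p with
      | nil => exact fun h _ => h
      | @cons s u _ hadj p ih =>
        intro hs hp
        exact ih (h1 ⟨hp u (List.mem_cons_of_mem _ p.start_mem_support), s, hadj, hs⟩)
          fun y hy => hp y (List.mem_cons_of_mem _ hy)
    exact key _ _ p (h0 ⟨rfl, hp _ p.start_mem_support⟩) hp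

/-- The table of `freeRel`, in array `3`. -/
def freeTable : Tabulation :=
  .table 2 (.add (.and (.eq (.col (.var 0)) (.col (.var 1))) (.not (.eq (.var 0) .start)))
    (.not (.sum 2 (.and (.eq (.col (.var 2)) (.col (.var 1))) (.entry 2 (.var 2) (.var 1))))))

theorem freeTable_spec (h : IsInput I σ) (h₂ : stored I.n σ 2 = avoidRel I) :
    (∀ b, b ≠ 3 → freeTable.run σ b = σ b) ∧ stored I.n (freeTable.run σ) 3 = freeRel I := by
  refine ⟨fun b hb => run_table_of_ne hb _ _, ?_⟩
  rw [freeTable, stored_run_table h.size]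
  ext ⟨u, v⟩
  rw [Set.mem_ofPred_eq, Term.pos_add, Term.pos_and, Term.pos_not, Term.pos_not,
    h.pos_eq_col (u := u) (v := v) rfl rfl, h.pos_eq_start (u := u) rfl, Term.pos_sum h.size]
  refine or_congr Iff.rfl ?_
  rw [not_exists]
  refine forall_congr' fun x => ?_
  rw [Term.pos_and, h.pos_eq_col (u := x) (v := v) rfl rfl,
    pos_entry h.size (k := x) (l := v) (by decide) rfl rfl, h₂, not_and]
  exact imp_congr_right fun _ => not_not

/-- The table of `reachRel`, in array `4`. -/
def reachTable : Tabulation :=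
  .closure 3 (.eq (.var 1) .start)
    (.sum 2 (.and (.adj (.var 2) (.var 1)) (.add
      (.and (.entry 3 (.var 2) (.var 1)) (.entry 4 (.var 0) (.var 2)))
      -- As a truth value `.var 0` says that the cost is positive, which guards the truncated
      -- subtraction.
      (.and (.var 0) (.entry 4 (.sub (.var 0) (.const 1)) (.var 2))))))

theorem reachTable_spec (h : IsInput I σ) (h₃ : stored I.n σ 3 = freeRel I) :
    (∀ b, b ≠ 4 → reachTable.run σ b = σ b) ∧ stored I.n (reachTable.run σ) 4 = reachRel I := by
  refine closure_spec (n := I.n) h.size (S₀ := {p | p.2 = I.start})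
    (F := fun S => {p | ∃ u, I.graph.Adj u p.2 ∧ ((u, p.2) ∈ freeRel I ∧ (p.1, u) ∈ S ∨
      0 < (p.1 : ℕ) ∧ ((⟨p.1 - 1, by omega⟩ : Fin I.n), u) ∈ S)}) ?_ ?_ ?_ ?_ ?_
  · exact fun i j => h.pos_eq_start rfl
  · intro τ hτ i j
    have hI := h.congr (hτ 0 (by decide))
    rw [Term.pos_sum hI.size]
    refine exists_congr fun w => ?_
    have hpred : 0 < (Term.entry 4 (.sub (.var 0) (.const 1)) (.var 2)).eval τ
        (Function.update (pairEnv i j) 2 w) ↔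
        ((⟨i - 1, by omega⟩ : Fin I.n), w) ∈ stored I.n τ 4 := by
      simp [Term.entry, Term.eval, hI.size, stored, pairEnv]
    rw [Term.pos_and, hI.pos_adj (u := w) (v := j) (by decide) rfl rfl, Term.pos_add,
      Term.pos_and, Term.pos_and, hpred,
      pos_entry hI.size (k := w) (l := j) (by decide) rfl rfl,
      pos_entry hI.size (k := i) (l := w) (by decide) rfl rfl,
      stored_congr (hτ 3 (by decide)), h₃]
    rfl
  · rintro ⟨d, v⟩ (rfl : v = I.start)
    exact .start _
  · rintro S hS ⟨d, v⟩ ⟨u, h1, ⟨h2, h3⟩ | ⟨h2, h3⟩⟩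
    · exact (hS h3).free h1 h2
    · have := (hS h3).pay h1
      rwa [Nat.sub_add_cancel h2] at this
  · rintro S h0 h1 ⟨⟨d, hd⟩, v⟩ hr
    change Reach I.graph I.col I.start (IsFinisher I.graph I.col I.start) d v at hr
    induction hr with
    | start d => exact h0 rfl
    | free _ h2 h3 ih => exact h1 ⟨_, h2, .inl ⟨h3, ih hd⟩⟩
    | pay _ h2 ih => exact h1 ⟨_, h2, .inr ⟨Nat.succ_pos _, ih (by omega)⟩⟩

/-! ### The decision -/

/-- The number of colors of the nodes other than the start node. -/
def otherColorsTerm : Term :=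
  .sum 2 (.and (.not (.eq (.var 2) .start)) (.not (.sum 3 (.and (.sub (.var 2) (.var 3))
    (.and (.not (.eq (.var 3) .start)) (.eq (.col (.var 3)) (.col (.var 2))))))))

/-- Each color is counted at its least node other than the start. As the exact value is needed,
`hval` shows that the summands are `0` or `1`. -/
theorem otherColorsTerm_eval (h : IsInput I σ) (ρ : Fin 10 → ℕ) :
    otherColorsTerm.eval σ ρ = otherColors I.col I.start := by
  classical
  let P : Fin I.n → Prop := fun v => v ≠ I.start ∧
    ¬ ∃ u, u < v ∧ u ≠ I.start ∧ I.col u = I.col v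
  have hval : ∀ a b : Term, ∀ ρ, (Term.and a (.not b)).eval σ ρ =
      if 0 < (Term.and a (.not b)).eval σ ρ then 1 else 0 := by
    intro a b ρ
    have h1 : (Term.and a (.not b)).eval σ ρ ≤ 1 := by
      by_cases ha : 0 < a.eval σ ρ <;> simp [Term.and, Term.not, Term.eval, ha]
    split_ifs <;> omega
  have h1 : otherColorsTerm.eval σ ρ = ({v | P v} : Finset (Fin I.n)).card := by
    rw [otherColorsTerm, Term.eval, h.size, Finset.card_filter, Finset.sum_range]
    refine Finset.sum_congr rfl fun v _ => ?_
    rw [hval]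
    refine if_congr ?_ rfl rfl
    rw [Term.pos_and, Term.pos_not, Term.pos_not, h.pos_eq_start (u := v) (by simp),
      Term.pos_sum h.size]
    refine and_congr Iff.rfl (not_congr (exists_congr fun u => ?_))
    rw [Term.pos_and, Term.pos_and, Term.pos_not, h.pos_eq_start (u := u) (by simp),
      h.pos_eq_col (u := u) (v := v) (by simp) (by simp), Term.pos_sub]
    simp [Term.eval]
  rw [h1, otherColors, ← Set.ncard_coe_finset]
  have himg : I.col '' {v | v ≠ I.start} = I.col '' {v | P v} := by
    refine Set.Subset.antisymm ?_ (Set.image_mono fun v hv => hv.1)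
    rintro _ ⟨v, hv, rfl⟩
    obtain ⟨w, ⟨hw1, hw2⟩, hw3⟩ := (wellFounded_lt (α := Fin I.n)).has_min
      {w | w ≠ I.start ∧ I.col w = I.col v} ⟨v, hv, rfl⟩
    exact ⟨w, ⟨hw1, fun ⟨u, h1, h2, h3⟩ => hw3 u ⟨h2, h3.trans hw2⟩ h1⟩, hw2⟩
  rw [himg, Set.InjOn.ncard_image]
  · simp
  · intro u hu v hv huv
    rcases lt_trichotomy u v with h | h | h
    · exact absurd ⟨u, h, hu.1, huv⟩ hv.2
    · exact h
    · exact absurd ⟨v, h, hv.1, huv.symm⟩ hu.2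

/-- There are a cost and a terminal node that is reached at this cost, and the cost and the number
of the other colors do not exceed the bound. -/
def answerTerm : Term :=
  .ite (.const 0) (.sum 0 (.sum 1 (.and (.entry 4 (.var 0) (.var 1))
    (.and (.not (.sum 2 (.entry 2 (.var 2) (.var 1))))
      -- The added `1` makes positivity of the difference mean `≤` instead of `<`.
      (.sub (.add (.cell 0 (.const 3)) (.const 1)) (.add (.var 0) otherColorsTerm))))))
    (.const 1) (.const 0)

/-- The order enters only here, through `IsCocompOrder.conquerableIn_iff`, and not in the tables. -/
theorem answerTerm_eval (h : IsInput I σ) (h₂ : stored I.n σ 2 = avoidRel I)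
    (h₄ : stored I.n σ 4 = reachRel I) (hI : I.IsExtremalCocomp) [Decidable I.IsYes]
    (ρ : Fin 10 → ℕ) : answerTerm.eval σ ρ = if I.IsYes then 1 else 0 := by
  rw [answerTerm, Term.eval]
  refine if_congr ?_ rfl rfl
  obtain ⟨-, r, hr, hv⟩ := hI
  rw [Instance.IsYes, hr.conquerableIn_iff hv, Term.eval, Term.pos_sum h.size]
  have hinner : ∀ d : Fin I.n, 0 < Term.eval σ (.sum 1 (.and (.entry 4 (.var 0) (.var 1))
      (.and (.not (.sum 2 (.entry 2 (.var 2) (.var 1))))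
      (.sub (.add (.cell 0 (.const 3)) (.const 1)) (.add (.var 0) otherColorsTerm)))))
      (Function.update ρ 0 d) ↔ ∃ w, Reach I.graph I.col I.start
        (IsFinisher I.graph I.col I.start) d w ∧ IsTerminal I.graph I.col I.start w ∧
        d + otherColors I.col I.start ≤ I.bound := by
    intro d
    rw [Term.pos_sum h.size]
    refine exists_congr fun w => ?_
    rw [Term.pos_and, Term.pos_and, Term.pos_not, Term.pos_sum h.size,
      pos_entry h.size (k := d) (l := w) (by decide) (by simp) (by simp), h₄, Term.pos_sub]
    refine and_congr Iff.rfl (and_congr ?_ ?_)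
    · rw [not_exists]
      refine forall_congr' fun x => ?_
      rw [pos_entry h.size (k := x) (l := w) (by decide) (by simp) (by simp), h₂]
      exact not_not
    · simp only [Term.eval, h.bound, otherColorsTerm_eval h]
      simp
  simp only [hinner]
  constructor
  · rintro ⟨d, w, h⟩
    exact ⟨d, w, h⟩
  · rintro ⟨d, w, h1, h2, h3⟩
    by_cases hd : d < I.n
    · exact ⟨⟨d, hd⟩, w, h1, h2, h3⟩
    -- Costs from `n` on are not tabulated, but paying for every step of a path to `w` costs less
    -- than `n`.
    · obtain ⟨-, -, p, -⟩ := h1.exists_conquered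
      have hlt := p.bypass_isPath.length_lt
      rw [Fintype.card_fin] at hlt
      refine ⟨⟨_, hlt⟩, w, .of_walk p.bypass, h2, ?_⟩
      change p.bypass.length + _ ≤ _
      omega

theorem solvableInPolyTime_extremalCocomp :
    SolvableInPolyTime Instance.encode Instance.IsExtremalCocomp Instance.IsYes := by
  classical
  have key : ∀ I : Instance, I.IsExtremalCocomp →
      answerTerm.eval ((Tabulation.seq nbhdTable (.seq avoidTable (.seq freeTable
        reachTable))).run (inputArrays I.encode)) (fun _ => 0) = if I.IsYes then 1 else 0 := by
    intro I hI
    have h := isInput_inputArrays I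
    obtain ⟨a₁, b₁⟩ := nbhdTable_spec h
    have h := h.congr (a₁ 0 (by decide))
    obtain ⟨a₂, b₂⟩ := avoidTable_spec h b₁
    have h := h.congr (a₂ 0 (by decide))
    obtain ⟨a₃, b₃⟩ := freeTable_spec h b₂
    have h := h.congr (a₃ 0 (by decide))
    obtain ⟨a₄, b₄⟩ := reachTable_spec h b₃
    refine answerTerm_eval (h.congr (a₄ 0 (by decide))) ?_ b₄ hI _
    rw [← b₂]
    exact stored_congr ((a₄ 2 (by decide)).trans (a₃ 2 (by decide)))
  refine solvableInPolyTime_of_tabulation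
    (.seq nbhdTable (.seq avoidTable (.seq freeTable reachTable))) answerTerm getD_encode_le
    (fun I hI hyes => ?_) fun I hI hno => ?_
  · rw [key I hI, if_pos hyes]
  · rw [key I hI, if_neg hno]

end Algorithm

end HoneyBee

theorem mainTheorem8 :
    HoneyBee.SolvableInPolyTime HoneyBee.Instance.encode HoneyBee.Instance.IsExtremalCocomp
      HoneyBee.Instance.IsYes ∧
    ∀ (V : Type*) (C : Type*) [Finite V] (G : SimpleGraph V) (col : V → C)
      (r : V → V → Prop) (v₀ : V),
      G.Connected → HoneyBee.IsCocompOrder G r → (∀ x y, G.Adj x y → col x ≠ col y) →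
      (HoneyBee.IsMinimalNode r v₀ → HoneyBee.OptimumFormula G col r v₀) ∧
      (HoneyBee.IsMaximalNode r v₀ → HoneyBee.OptimumFormula G col (fun x y => r y x) v₀) :=
  ⟨HoneyBee.solvableInPolyTime_extremalCocomp, fun _ _ _ _ _ _ _ hG hr hcol =>
    ⟨HoneyBee.optimumFormula_of_isMinimalNode hG hr hcol,
      HoneyBee.optimumFormula_of_isMinimalNode hG hr.swap hcol⟩⟩
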